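/- Let $\pi:E\to M$ be a smooth submersion between smooth manifolds (for instance the projection of a smooth fibre bundle), $\dim M=n$, $\dim E=m=n+k\ge 1$. Let $L_\pi E$ be the adapted frame bundle: its points are the frames $u=(e_i,e_A)_e$ ($1\le i\le n$, $1\le A\le k$) of the tangent spaces $T_eE$, $e\in E$, with $\pi_*(e_A)=0$ for all $A$. It is a smooth manifold (with the charts given by coordinates of $E$ adapted to $\pi$ and the components of the frame in these coordinates), with projection $\lambda:L_\pi E\to E$ and a right action of the group of invertible block lower triangular matrices. For $X\in T_u(L_\pi E)$ let $\theta^i(X),\theta^A(X)$ be the components of $\lambda_*X$ with respect to the frame $u$ (the soldering form). For a matrix $\xi$ in the Lie algebra of this group let $\xi^*(u)=\frac{d}{dt}\big|_{t=0}u\cdot\exp(t\xi)$ be the fundamental vertical vector field, and let $E^{*i}_j$, $E^{*A}_B$, $E^{*i}_A$ be the fundamental fields of the matrix units, which move $e_i$ in the direction $e_j$, $e_A$ in the direction $e_B$, and $e_i$ in the direction $e_A$, respectively. Let $L:L_\pi E\to\mathbb R$ be a smooth lifted Lagrangian, i.e. $E^{*i}_j(L)=0$ and $E^{*A}_B(L)=0$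 for all $i,j,A,B$, and assume that $L$ is non-zero, i.e. $L(u)\neq0$ for every $u$. Let $\tau(n)>0$ and let $\hat\theta_L=(\theta^i_L,\theta^A_L)$ be the $\mathbb R^m$-valued $1$-form of the Cartan–Hamilton–Poincaré $1$-forms $$\theta^i_L=\tau(n)\,L\,\theta^i+\sum_{A}E^{*i}_A(L)\,\theta^A,\qquad \theta^A_L=\theta^A .$$ Then $(L_\pi E,d\hat\theta_L)$ is a (general) $m$-symplectic manifold: $1\le m\le\dim L_\pi E$, and $d\hat\theta_L$ is a smooth $\mathbb R^m$-valued $2$-form on the manifold $L_\pi E$ that is closed, $d(d\hat\theta_L)=0$, and non-degenerate, i.e. for $X\in T_u(L_\pi E)$ one has $d\hat\theta_L(X,Y)=0$ for all $Y\in T_u(L_\pi E)$ if and only if $X=0$. -/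

import Mathlib

open scoped Manifold ContDiff Topology

/-! ## Vector-valued differential forms on a (boundaryless) smooth manifold -/

namespace ManifoldForm

section

variable {F : Type*} [NormedAddCommGroup F] [NormedSpace ℝ F]
  {P : Type*} [TopologicalSpace P] [ChartedSpace F P]
  {W : Type*} [NormedAddCommGroup W] [NormedSpace ℝ W] {p : ℕ}

/-- The local representative of a `W`-valued `p`-form `α` in a chart `φ`: the pull-back of `α`
under the inverse chart, a form on (an open subset of) the model space. -/
noncomputable def inChart (α : ∀ u : P, TangentSpace 𝓘(ℝ, F) u [⋀^Fin p]→L[ℝ] W)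
    (φ : OpenPartialHomeomorph P F) (z : F) : F [⋀^Fin p]→L[ℝ] W :=
  (α (φ.symm z)).compContinuousLinearMap
    (mfderiv 𝓘(ℝ, F) 𝓘(ℝ, F) φ.symm z : F →L[ℝ] TangentSpace 𝓘(ℝ, F) (φ.symm z))

/-- A form is smooth if all its local representatives in the charts of the atlas are. -/
def IsSmooth (α : ∀ u : P, TangentSpace 𝓘(ℝ, F) u [⋀^Fin p]→L[ℝ] W) : Prop :=
  ∀ φ ∈ atlas F P, ContDiffOn ℝ ∞ (inChart α φ) φ.target

/-- The exterior derivative of a `W`-valued form: at `u` it is computed in the preferred chart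
at `u`. -/
noncomputable def d (α : ∀ u : P, TangentSpace 𝓘(ℝ, F) u [⋀^Fin p]→L[ℝ] W) (u : P) :
    TangentSpace 𝓘(ℝ, F) u [⋀^Fin (p + 1)]→L[ℝ] W :=
  (extDeriv (inChart α (chartAt F u)) (chartAt F u u)).compContinuousLinearMap
    (mfderiv 𝓘(ℝ, F) 𝓘(ℝ, F) (chartAt F u) u : TangentSpace 𝓘(ℝ, F) u →L[ℝ] F)

/-- A `1`-form given as a family of continuous linear maps, regarded as an alternating form. -/
noncomputable def ofOneForm (θ : ∀ u : P, TangentSpace 𝓘(ℝ, F) u →L[ℝ] W) (u : P) :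
    TangentSpace 𝓘(ℝ, F) u [⋀^Fin 1]→L[ℝ] W :=
  ContinuousAlternatingMap.ofSubsingleton ℝ (TangentSpace 𝓘(ℝ, F) u) W (0 : Fin 1) (θ u)

end

/-- A (general) `m`-symplectic structure on the manifold `P`, where `m` is the cardinality of `ι`,
`1 ≤ m ≤ dim P`: a smooth `ℝ^ι`-valued `2`-form which is closed and non-degenerate. -/
structure IsMSymplectic {F : Type*} [NormedAddCommGroup F] [NormedSpace ℝ F]
    {P : Type*} [TopologicalSpace P] [ChartedSpace F P] {ι : Type*} [Fintype ι]
    (α : ∀ u : P, TangentSpace 𝓘(ℝ, F) u [⋀^Fin 2]→L[ℝ] (ι → ℝ)) : Prop where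
  isManifold : IsManifold 𝓘(ℝ, F) ∞ P
  one_le : 1 ≤ Fintype.card ι
  le_dim : Fintype.card ι ≤ Module.finrank ℝ F
  smooth : IsSmooth α
  closed : ∀ u, d α u = 0
  nondegenerate : ∀ (u : P) (X : TangentSpace 𝓘(ℝ, F) u),
    (∀ Y : TangentSpace 𝓘(ℝ, F) u, α u ![X, Y] = 0) ↔ X = 0

end ManifoldForm

/-! ## The adapted frame bundle of a submersion -/

section

variable {n k : ℕ}
  {M : Type*} [TopologicalSpace M] [ChartedSpace (EuclideanSpace ℝ (Fin n)) M]
  {E : Type*} [TopologicalSpace E] [ChartedSpace (EuclideanSpace ℝ (Fin (n + k))) E]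
  {π : E → M}

/-- The adapted frame bundle `L_π E` of a smooth submersion `π : E → M`, with `dim M = n` and
`dim E = n + k`: its points are the frames `(e_i, e_A)` of the tangent spaces of `E` whose last `k`
vectors `e_A` are vertical. -/
@[ext]
structure AdaptedFrameBundle (hπ : Manifold.IsSubmersion (𝓡 (n + k)) (𝓡 n) ∞ π) where
  /-- The base point in `E`. -/
  pt : E
  /-- The frame at the base point. -/
  frame : Module.Basis (Fin n ⊕ Fin k) ℝ (TangentSpace (𝓡 (n + k)) pt)
  vertical : ∀ A : Fin k, mfderiv (𝓡 (n + k)) (𝓡 n) π pt (frame (Sum.inr A)) = 0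

namespace AdaptedFrameBundle

/-- A chart of `E` is adapted to `π` if in it, and in some chart of `M`, the map `π` is the
projection to the first `n` coordinates. -/
def IsAdaptedChart (π : E → M)
    (φ : OpenPartialHomeomorph E (EuclideanSpace ℝ (Fin (n + k)))) : Prop :=
  φ ∈ IsManifold.maximalAtlas (𝓡 (n + k)) ∞ E ∧
  ∃ ψ ∈ IsManifold.maximalAtlas (𝓡 n) ∞ M, (∀ e ∈ φ.source, π e ∈ ψ.source) ∧
    ∀ e ∈ φ.source, ∀ i : Fin n, ψ (π e) i = φ e (Fin.castAdd k i)

theorem exists_isAdaptedChart [IsManifold (𝓡 (n + k)) ∞ E]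
    (hπ : Manifold.IsSubmersion (𝓡 (n + k)) (𝓡 n) ∞ π) (e : E) :
    ∃ φ : OpenPartialHomeomorph E (EuclideanSpace ℝ (Fin (n + k))),
      IsAdaptedChart π φ ∧ e ∈ φ.source := by
  obtain ⟨F, _, _, hF⟩ := hπ
  obtain ⟨⟨φ, ψ, he, hπe, hφ, hψ, hsub, ℓ, hℓ⟩⟩ := hF e
  have : FiniteDimensional ℝ (EuclideanSpace ℝ (Fin n) × F) := ℓ.toLinearEquiv.finiteDimensional
  have hFfin : FiniteDimensional ℝ F :=
    Module.Finite.of_surjective (LinearMap.snd ℝ (EuclideanSpace ℝ (Fin n)) F)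
      LinearMap.snd_surjective
  have hdim : Module.finrank ℝ F = Module.finrank ℝ (EuclideanSpace ℝ (Fin k)) := by
    have := ℓ.toLinearEquiv.finrank_eq
    rw [Module.finrank_prod] at this
    simp at this ⊢
    omega
  let κ : F ≃L[ℝ] EuclideanSpace ℝ (Fin k) := ContinuousLinearEquiv.ofFinrankEq hdim
  let σ : EuclideanSpace ℝ (Fin (n + k)) ≃L[ℝ] EuclideanSpace ℝ (Fin (n + k)) :=
    (ℓ.trans ((ContinuousLinearEquiv.refl ℝ _).prodCongr κ)).trans
      EuclideanSpace.finAddEquivProd.symm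
  have hσ : ∀ z i, σ z (Fin.castAdd k i) = (ℓ z).1 i := by
    intro z i
    have h1 : (EuclideanSpace.finAddEquivProd (𝕜 := ℝ) (n := n) (m := k) (σ z)).1 = (ℓ z).1 := by
      simp [σ]
    rw [← h1]
    simp [EuclideanSpace.finAddEquivProd, EuclideanSpace.sumEquivProd]
  refine ⟨φ ≫ₕ σ.toHomeomorph.toOpenPartialHomeomorph, ⟨?_, ψ, hψ, ?_, ?_⟩, ?_⟩
  · refine OpenPartialHomeomorph.mem_maximalAtlas_of_contMDiffOn (M := E)
      (I := 𝓡 (n + k)) (n := ∞) _ ?_ ?_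
    · have h1 := contMDiffOn_of_mem_maximalAtlas hφ
      have h2 : ContMDiff (𝓡 (n + k)) (𝓡 (n + k)) ∞ σ := σ.contDiff.contMDiff
      exact (h2.comp_contMDiffOn h1).mono (by simp)
    · have h1 := contMDiffOn_symm_of_mem_maximalAtlas hφ
      have h2 : ContMDiff (𝓡 (n + k)) (𝓡 (n + k)) ∞ σ.symm := σ.symm.contDiff.contMDiff
      refine h1.comp h2.contMDiffOn ?_
      intro z hz
      simpa using hz
  · intro x hx
    exact hsub (by simpa using hx)
  · intro x hx i
    have hx' : x ∈ φ.source := by simpa using hx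
    have := hℓ (x := φ x) (by simpa using φ.map_source hx')
    simp [hx'] at this
    simp [hσ, ← this]
  · simpa using he

theorem IsAdaptedChart.mdifferentiable [IsManifold (𝓡 (n + k)) ∞ E]
    {φ : OpenPartialHomeomorph E (EuclideanSpace ℝ (Fin (n + k)))} (hφ : IsAdaptedChart π φ) :
    φ.MDifferentiable (𝓡 (n + k)) (𝓡 (n + k)) :=
  ⟨(contMDiffOn_of_mem_maximalAtlas hφ.1).mdifferentiableOn (by simp),
    (contMDiffOn_symm_of_mem_maximalAtlas hφ.1).mdifferentiableOn (by simp)⟩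

/-- The differential of a chart of `E` at a point, with values in the model space. -/
noncomputable def chartDeriv (φ : OpenPartialHomeomorph E (EuclideanSpace ℝ (Fin (n + k)))) (e : E) :
    TangentSpace (𝓡 (n + k)) e →L[ℝ] EuclideanSpace ℝ (Fin (n + k)) :=
  mfderiv (𝓡 (n + k)) (𝓡 (n + k)) φ e

theorem IsAdaptedChart.mfderiv_eq_zero_iff [IsManifold (𝓡 (n + k)) ∞ E] [IsManifold (𝓡 n) ∞ M]
    (hπ : Manifold.IsSubmersion (𝓡 (n + k)) (𝓡 n) ∞ π)
    {φ : OpenPartialHomeomorph E (EuclideanSpace ℝ (Fin (n + k)))} (hφ : IsAdaptedChart π φ)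
    {e : E} (he : e ∈ φ.source) (X : TangentSpace (𝓡 (n + k)) e) :
    mfderiv (𝓡 (n + k)) (𝓡 n) π e X = 0 ↔
      ∀ i : Fin n, chartDeriv φ e X (Fin.castAdd k i) = 0 := by
  obtain ⟨-, ψ, hψ, hsub, hcoord⟩ := id hφ
  have hψd : ψ.MDifferentiable (𝓡 n) (𝓡 n) :=
    ⟨(contMDiffOn_of_mem_maximalAtlas hψ).mdifferentiableOn (by simp),
      (contMDiffOn_symm_of_mem_maximalAtlas hψ).mdifferentiableOn (by simp)⟩
  have hπd : MDifferentiableAt (𝓡 (n + k)) (𝓡 n) π e := (hπ.contMDiff e).mdifferentiableAt (by simp)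
  let p : EuclideanSpace ℝ (Fin (n + k)) →L[ℝ] EuclideanSpace ℝ (Fin n) :=
    (ContinuousLinearMap.fst ℝ _ _).comp
      (EuclideanSpace.finAddEquivProd (𝕜 := ℝ) (n := n) (m := k)).toContinuousLinearMap
  have hp : ∀ z i, p z i = z (Fin.castAdd k i) := by
    intro z i
    simp [p, EuclideanSpace.finAddEquivProd, EuclideanSpace.sumEquivProd]
  have hev : ψ ∘ π =ᶠ[𝓝 e] p ∘ φ := by
    filter_upwards [φ.open_source.mem_nhds he] with x hx
    ext i
    simp [hp, hcoord x hx i]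
  have h1 := hev.mfderiv_eq (I := 𝓡 (n + k)) (I' := 𝓡 n)
  have hpd : MDifferentiableAt (𝓡 (n + k)) (𝓡 n) p (φ e) := p.mdifferentiableAt
  rw [mfderiv_comp e (hψd.mdifferentiableAt (hsub e he)) hπd,
    mfderiv_comp e hpd (hφ.mdifferentiable.mdifferentiableAt he)] at h1
  have h2 : mfderiv (𝓡 n) (𝓡 n) ψ (π e) (mfderiv (𝓡 (n + k)) (𝓡 n) π e X) =
      p (chartDeriv φ e X) := by
    have h3 := congrArg (fun T => T X) h1
    have h4 : mfderiv (𝓡 (n + k)) (𝓡 n) p (φ e) = p := by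
      rw [mfderiv_eq_fderiv]; exact p.fderiv
    rw [h4] at h3
    exact h3
  have hinj := hψd.mfderiv_injective (hsub e he)
  constructor
  · intro h i
    rw [h, map_zero] at h2
    rw [← hp, ← h2]
    rfl
  · intro h
    apply hinj
    rw [h2, map_zero]
    have h5 : p (chartDeriv φ e X) = 0 := by
      ext i
      rw [hp, h i]
      rfl
    exact h5

variable {hπ : Manifold.IsSubmersion (𝓡 (n + k)) (𝓡 n) ∞ π}

/-- The frame `u`, regarded as the linear isomorphism `ℝ^{n+k} → T_e E` sending the standard basis
to the frame. -/
noncomputable def frameIso (u : AdaptedFrameBundle hπ) :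
    (Fin n ⊕ Fin k → ℝ) ≃L[ℝ] TangentSpace (𝓡 (n + k)) u.pt :=
  haveI : T2Space (TangentSpace (𝓡 (n + k)) u.pt) :=
    inferInstanceAs (T2Space (EuclideanSpace ℝ (Fin (n + k))))
  u.frame.equivFunL.symm

theorem frameIso_single (u : AdaptedFrameBundle hπ) (a : Fin n ⊕ Fin k) :
    u.frameIso (Pi.single a 1) = u.frame a := by
  change u.frame.equivFun.symm (Pi.single a 1) = u.frame a
  simp

variable (n k) in
/-- The space of the components `(v^i_j, v^A_j, v^A_B)` of adapted frames, that is, of block lower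
triangular `(n + k) × (n + k)` matrices. -/
abbrev FrameModel : Type :=
  (Fin n → Fin n → ℝ) × (Fin k → Fin n → ℝ) × (Fin k → Fin k → ℝ)

/-- The three blocks on and below the diagonal of a linear map. -/
noncomputable def blocks :
    ((Fin n ⊕ Fin k → ℝ) →L[ℝ] EuclideanSpace ℝ (Fin (n + k))) →ₗ[ℝ] FrameModel n k where
  toFun V := (fun i j => V (Pi.single (Sum.inl j) 1) (Fin.castAdd k i),
    fun A j => V (Pi.single (Sum.inl j) 1) (Fin.natAdd n A),
    fun A B => V (Pi.single (Sum.inr B) 1) (Fin.natAdd n A))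
  map_add' _ _ := rfl
  map_smul' _ _ := rfl

theorem blocks_apply (V : (Fin n ⊕ Fin k → ℝ) →L[ℝ] EuclideanSpace ℝ (Fin (n + k))) :
    blocks V = (fun i j => V (Pi.single (Sum.inl j) 1) (Fin.castAdd k i),
      fun A j => V (Pi.single (Sum.inl j) 1) (Fin.natAdd n A),
      fun A B => V (Pi.single (Sum.inr B) 1) (Fin.natAdd n A)) := rfl

/-- The block lower triangular linear map with given blocks. -/
noncomputable def ofBlocks :
    FrameModel n k →ₗ[ℝ] (Fin n ⊕ Fin k → ℝ) →L[ℝ] EuclideanSpace ℝ (Fin (n + k)) where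
  toFun b := LinearMap.toContinuousLinearMap
    { toFun := fun w => WithLp.toLp 2 (Fin.addCases
        (fun i => ∑ j, b.1 i j * w (Sum.inl j))
        (fun A => ∑ j, b.2.1 A j * w (Sum.inl j) + ∑ B, b.2.2 A B * w (Sum.inr B)))
      map_add' := fun w w' => by
        ext a
        induction a using Fin.addCases <;> simp [mul_add, Finset.sum_add_distrib]
        ring
      map_smul' := fun c w => by
        ext a
        induction a using Fin.addCases <;>
          simp [mul_add, Finset.mul_sum, mul_left_comm] }
  map_add' b b' := by
    ext w a
    induction a using Fin.addCases <;> simp [add_mul, Finset.sum_add_distrib]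
    ring
  map_smul' c b := by
    ext w a
    induction a using Fin.addCases <;> simp [mul_add, Finset.mul_sum, mul_assoc]

theorem ofBlocks_castAdd (b : FrameModel n k) (w : Fin n ⊕ Fin k → ℝ) (i : Fin n) :
    ofBlocks b w (Fin.castAdd k i) = ∑ j, b.1 i j * w (Sum.inl j) := by
  simp [ofBlocks]

theorem ofBlocks_natAdd (b : FrameModel n k) (w : Fin n ⊕ Fin k → ℝ) (A : Fin k) :
    ofBlocks b w (Fin.natAdd n A) =
      ∑ j, b.2.1 A j * w (Sum.inl j) + ∑ B, b.2.2 A B * w (Sum.inr B) := by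
  simp [ofBlocks]

theorem blocks_ofBlocks (b : FrameModel n k) : blocks (ofBlocks b) = b := by
  refine Prod.ext ?_ (Prod.ext ?_ ?_) <;> ext <;>
    simp [blocks_apply, ofBlocks_castAdd, ofBlocks_natAdd, Pi.single_apply]

theorem ofBlocks_single_inr (b : FrameModel n k) (A : Fin k) (i : Fin n) :
    ofBlocks b (Pi.single (Sum.inr A) 1) (Fin.castAdd k i) = 0 := by
  simp [ofBlocks_castAdd]

theorem ofBlocks_blocks {V : (Fin n ⊕ Fin k → ℝ) →L[ℝ] EuclideanSpace ℝ (Fin (n + k))}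
    (hV : ∀ (A : Fin k) (i : Fin n), V (Pi.single (Sum.inr A) 1) (Fin.castAdd k i) = 0) :
    ofBlocks (blocks V) = V := by
  apply ContinuousLinearMap.coe_injective
  refine (Pi.basisFun ℝ (Fin n ⊕ Fin k)).ext fun a => ?_
  ext c
  induction c using Fin.addCases <;> rcases a with a | a <;>
    simp [blocks_apply, ofBlocks_castAdd, ofBlocks_natAdd, Pi.single_apply, hV]

/-- The components of a frame `u` in a chart of `E`. -/
noncomputable def velocity (φ : OpenPartialHomeomorph E (EuclideanSpace ℝ (Fin (n + k))))
    (u : AdaptedFrameBundle hπ) :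
    (Fin n ⊕ Fin k → ℝ) →L[ℝ] EuclideanSpace ℝ (Fin (n + k)) :=
  (chartDeriv φ u.pt).comp
    (u.frameIso : (Fin n ⊕ Fin k → ℝ) →L[ℝ] TangentSpace (𝓡 (n + k)) u.pt)

theorem velocity_single_inr [IsManifold (𝓡 (n + k)) ∞ E] [IsManifold (𝓡 n) ∞ M]
    {φ : OpenPartialHomeomorph E (EuclideanSpace ℝ (Fin (n + k)))}
    (hφ : IsAdaptedChart π φ) (u : AdaptedFrameBundle hπ) (hu : u.pt ∈ φ.source)
    (A : Fin k) (i : Fin n) :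
    velocity φ u (Pi.single (Sum.inr A) 1) (Fin.castAdd k i) = 0 := by
  have h := (hφ.mfderiv_eq_zero_iff hπ hu _).1 (u.vertical A) i
  rw [← frameIso_single] at h
  exact h

/-- The coordinates on `L_π E` induced by an adapted chart of `E`: the coordinates of the base
point, and the components `(v^i_j, v^A_j, v^A_B)` of the frame. -/
noncomputable def coord (φ : OpenPartialHomeomorph E (EuclideanSpace ℝ (Fin (n + k))))
    (u : AdaptedFrameBundle hπ) : EuclideanSpace ℝ (Fin (n + k)) × FrameModel n k :=
  (φ u.pt, blocks (velocity φ u))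

theorem ofBlocks_coord [IsManifold (𝓡 (n + k)) ∞ E] [IsManifold (𝓡 n) ∞ M]
    {φ : OpenPartialHomeomorph E (EuclideanSpace ℝ (Fin (n + k)))}
    (hφ : IsAdaptedChart π φ) (u : AdaptedFrameBundle hπ) (hu : u.pt ∈ φ.source) :
    ofBlocks (coord φ u).2 = velocity φ u :=
  ofBlocks_blocks (velocity_single_inr hφ u hu)

theorem bijOn_coord [IsManifold (𝓡 (n + k)) ∞ E] [IsManifold (𝓡 n) ∞ M]
    {φ : OpenPartialHomeomorph E (EuclideanSpace ℝ (Fin (n + k)))} (hφ : IsAdaptedChart π φ) :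
    Set.BijOn (coord (hπ := hπ) φ) {u | u.pt ∈ φ.source}
      {q | q.1 ∈ φ.target ∧ (ofBlocks q.2).IsInvertible} := by
  refine ⟨?_, ?_, ?_⟩
  · intro u hu
    refine ⟨φ.map_source hu, ?_⟩
    rw [ofBlocks_coord hφ u hu]
    exact ⟨u.frameIso.trans (hφ.mdifferentiable.mfderiv hu), rfl⟩
  · intro u hu u' hu' h
    have h1 : u.pt = u'.pt := φ.injOn hu hu' (congrArg Prod.fst h)
    have h2 : velocity φ u = velocity φ u' := by
      rw [← ofBlocks_coord hφ u hu, ← ofBlocks_coord hφ u' hu', h]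
    obtain ⟨e, b, hb⟩ := u
    obtain ⟨e', b', hb'⟩ := u'
    obtain rfl : e = e' := h1
    congr 1
    apply Module.Basis.eq_of_apply_eq
    intro a
    have h3 := congrArg (fun T => T (Pi.single a 1)) h2
    have h4 := hφ.mdifferentiable.mfderiv_injective hu h3
    exact (frameIso_single _ a).symm.trans (h4.trans (frameIso_single _ a))
  · rintro ⟨z, V⟩ ⟨hz, ℓ, hℓ⟩
    have hz' : z ∈ φ.symm.source := hz
    let D := hφ.mdifferentiable.symm.mfderiv hz'
    let b : Module.Basis (Fin n ⊕ Fin k) ℝ (TangentSpace (𝓡 (n + k)) (φ.symm z)) :=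
      Module.Basis.ofEquivFun (ℓ.toLinearEquiv.trans D.toLinearEquiv).symm
    have hD : ∀ w : EuclideanSpace ℝ (Fin (n + k)), chartDeriv φ (φ.symm z) (D w) = w := fun w =>
      congrArg (fun T => T w) (hφ.mdifferentiable.comp_symm_deriv hz)
    have hb : ∀ a, b a = D (ℓ (Pi.single a 1)) := by
      intro a
      simp [b]
      rfl
    have hmem := φ.map_target hz
    have hvert : ∀ A : Fin k, mfderiv (𝓡 (n + k)) (𝓡 n) π (φ.symm z) (b (Sum.inr A)) = 0 := by
      intro A
      rw [hφ.mfderiv_eq_zero_iff hπ hmem]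
      intro i
      have h5 := ofBlocks_single_inr V A i
      rw [show ofBlocks V = (ℓ : _ →L[ℝ] _) from hℓ.symm] at h5
      rw [hb]
      exact (congrArg (fun w : EuclideanSpace ℝ (Fin (n + k)) => w (Fin.castAdd k i))
        (hD _)).trans h5
    let u : AdaptedFrameBundle hπ := ⟨φ.symm z, b, hvert⟩
    refine ⟨u, hmem, Prod.ext (φ.right_inv hz) ?_⟩
    have h7 : velocity φ u = ofBlocks V := by
      apply ContinuousLinearMap.coe_injective
      refine (Pi.basisFun ℝ (Fin n ⊕ Fin k)).ext fun a => ?_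
      have h6 : velocity φ u (Pi.single a 1) = ofBlocks V (Pi.single a 1) := by
        rw [show ofBlocks V = (ℓ : _ →L[ℝ] _) from hℓ.symm]
        change chartDeriv φ u.pt (u.frameIso (Pi.single a 1)) = _
        rw [frameIso_single]
        change chartDeriv φ (φ.symm z) (b a) = _
        rw [hb]
        exact hD _
      simpa using h6
    change blocks (velocity φ u) = V
    rw [h7, blocks_ofBlocks]

theorem nonempty_of_chart [IsManifold (𝓡 (n + k)) ∞ E] [IsManifold (𝓡 n) ∞ M]
    (hπ : Manifold.IsSubmersion (𝓡 (n + k)) (𝓡 n) ∞ π)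
    (φ : OpenPartialHomeomorph E (EuclideanSpace ℝ (Fin (n + k)))) :
    Nonempty (AdaptedFrameBundle hπ) := by
  obtain ⟨φ', hφ', he⟩ := exists_isAdaptedChart hπ (φ.symm 0)
  let ℓ : (Fin n ⊕ Fin k → ℝ) ≃L[ℝ] EuclideanSpace ℝ (Fin (n + k)) :=
    ((LinearEquiv.funCongrLeft ℝ ℝ finSumFinEquiv.symm).toContinuousLinearEquiv).trans
      (EuclideanSpace.equiv _ ℝ).symm
  have hℓ : ofBlocks (blocks (ℓ : (Fin n ⊕ Fin k → ℝ) →L[ℝ] EuclideanSpace ℝ (Fin (n + k)))) =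
      ℓ := by
    apply ofBlocks_blocks
    intro A i
    simp [ℓ, LinearEquiv.funCongrLeft]
  obtain ⟨u, -⟩ := (bijOn_coord (hπ := hπ) hφ').surjOn
    (show (φ' (φ.symm 0), blocks (ℓ : (Fin n ⊕ Fin k → ℝ) →L[ℝ] _)) ∈ _ from
      ⟨φ'.map_source he, ℓ, hℓ.symm⟩)
  exact ⟨u⟩

/-- The chart of `L_π E` induced by an adapted chart of `E`. -/
noncomputable def frameChart [IsManifold (𝓡 (n + k)) ∞ E] [IsManifold (𝓡 n) ∞ M]
    (hπ : Manifold.IsSubmersion (𝓡 (n + k)) (𝓡 n) ∞ π)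
    {φ : OpenPartialHomeomorph E (EuclideanSpace ℝ (Fin (n + k)))} (hφ : IsAdaptedChart π φ) :
    PartialEquiv (AdaptedFrameBundle hπ)
      (EuclideanSpace ℝ (Fin (n + k)) × FrameModel n k) :=
  haveI := nonempty_of_chart hπ φ
  Set.BijOn.toPartialEquiv (coord φ) _ _ (bijOn_coord hφ)

/-- The transition map between two induced charts is `(z, V) ↦ (τ z, Dτ(z) ∘ V)`, where `τ` is the
transition map of `E`. -/
theorem frameChart_transition [IsManifold (𝓡 (n + k)) ∞ E] [IsManifold (𝓡 n) ∞ M]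
    {φ φ' : OpenPartialHomeomorph E (EuclideanSpace ℝ (Fin (n + k)))} (hφ : IsAdaptedChart π φ)
    (hφ' : IsAdaptedChart π φ')
    {q : EuclideanSpace ℝ (Fin (n + k)) × FrameModel n k}
    (hq : q ∈ ((frameChart hπ hφ).symm.trans (frameChart hπ hφ')).source) :
    ((frameChart hπ hφ).symm.trans (frameChart hπ hφ') q).1 = φ' (φ.symm q.1) ∧
    ((frameChart hπ hφ).symm.trans (frameChart hπ hφ') q).2 =
      blocks ((fderiv ℝ (φ' ∘ φ.symm) q.1).comp (ofBlocks q.2)) := by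
  rw [PartialEquiv.trans_source] at hq
  obtain ⟨hq1, hq2⟩ := hq
  set u := (frameChart hπ hφ).symm q with hu
  have hus : u.pt ∈ φ.source := (frameChart hπ hφ).map_target hq1
  have hus' : u.pt ∈ φ'.source := hq2
  have hr : coord φ u = q := (frameChart hπ hφ).right_inv hq1
  have hr1 : φ u.pt = q.1 := congrArg Prod.fst hr
  have hr2 : velocity φ u = ofBlocks q.2 := by rw [← ofBlocks_coord hφ u hus, hr]
  have hpt : φ.symm q.1 = u.pt := by rw [← hr1, φ.left_inv hus]
  change (coord φ' u).1 = _ ∧ blocks (velocity φ' u) = _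
  refine ⟨by rw [hpt]; rfl, congrArg blocks ?_⟩
  rw [← hr2]
  ext1 w
  have hd : mfderiv (𝓡 (n + k)) (𝓡 (n + k)) (φ' ∘ φ.symm) q.1 =
      (mfderiv (𝓡 (n + k)) (𝓡 (n + k)) φ' (φ.symm q.1)).comp
        (mfderiv (𝓡 (n + k)) (𝓡 (n + k)) φ.symm q.1) :=
    mfderiv_comp q.1 (hφ'.mdifferentiable.mdifferentiableAt (by rwa [hpt]))
      (hφ.mdifferentiable.mdifferentiableAt_symm hq1.1)
  rw [mfderiv_eq_fderiv] at hd
  rw [hd]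
  have hinv := congrArg (fun T => T (u.frameIso w)) (hφ.mdifferentiable.symm_comp_deriv hus)
  rw [hr1] at hinv
  change chartDeriv φ' u.pt (u.frameIso w) = mfderiv (𝓡 (n + k)) (𝓡 (n + k)) φ' (φ.symm q.1)
    (mfderiv (𝓡 (n + k)) (𝓡 (n + k)) φ.symm q.1 (chartDeriv φ u.pt (u.frameIso w)))
  have hinv' : mfderiv (𝓡 (n + k)) (𝓡 (n + k)) φ.symm q.1 (chartDeriv φ u.pt (u.frameIso w)) =
    u.frameIso w := hinv
  rw [hinv', hpt]
  rfl

theorem source_frameChart_transition [IsManifold (𝓡 (n + k)) ∞ E] [IsManifold (𝓡 n) ∞ M]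
    {φ φ' : OpenPartialHomeomorph E (EuclideanSpace ℝ (Fin (n + k)))} (hφ : IsAdaptedChart π φ)
    (hφ' : IsAdaptedChart π φ') :
    ((frameChart hπ hφ).symm.trans (frameChart hπ hφ')).source =
      {q | q.1 ∈ (φ.symm.trans φ').source ∧ (ofBlocks q.2).IsInvertible} := by
  ext q
  rw [PartialEquiv.trans_source]
  have key : q ∈ (frameChart hπ hφ).target →
      ((frameChart hπ hφ).symm q).pt = φ.symm q.1 := by
    intro hq
    have hus : ((frameChart hπ hφ).symm q).pt ∈ φ.source := (frameChart hπ hφ).map_target hq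
    have hr : coord φ ((frameChart hπ hφ).symm q) = q := (frameChart hπ hφ).right_inv hq
    have hr1 : φ ((frameChart hπ hφ).symm q).pt = q.1 := congrArg Prod.fst hr
    rw [← hr1, φ.left_inv hus]
  constructor
  · rintro ⟨h1, h2⟩
    have h2' : ((frameChart hπ hφ).symm q).pt ∈ φ'.source := h2
    rw [key h1] at h2'
    exact ⟨by simpa using ⟨h1.1, h2'⟩, h1.2⟩
  · rintro ⟨h1, h2⟩
    have h3 : q.1 ∈ φ.target ∧ φ.symm q.1 ∈ φ'.source := by simpa using h1
    have h4 : q ∈ (frameChart hπ hφ).target := ⟨h3.1, h2⟩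
    refine ⟨h4, ?_⟩
    change ((frameChart hπ hφ).symm q).pt ∈ φ'.source
    rw [key h4]
    exact h3.2

theorem contDiffOn_frameChart_transition [IsManifold (𝓡 (n + k)) ∞ E] [IsManifold (𝓡 n) ∞ M]
    {φ φ' : OpenPartialHomeomorph E (EuclideanSpace ℝ (Fin (n + k)))} (hφ : IsAdaptedChart π φ)
    (hφ' : IsAdaptedChart π φ') :
    ContDiffOn ℝ ∞ ((frameChart hπ hφ).symm.trans (frameChart hπ hφ'))
      ((frameChart hπ hφ).symm.trans (frameChart hπ hφ')).source := by
  have hopen : IsOpen (φ.symm.trans φ').source := (φ.symm.trans φ').open_source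
  have hτ : ContDiffOn ℝ ∞ (φ' ∘ φ.symm) (φ.symm.trans φ').source := by
    rw [← contMDiffOn_iff_contDiffOn]
    refine (contMDiffOn_of_mem_maximalAtlas hφ'.1).comp
      ((contMDiffOn_symm_of_mem_maximalAtlas hφ.1).mono ?_) ?_
    · intro z hz
      simpa using hz.1
    · intro z hz
      simpa using hz.2
  have hτ' : ContDiffOn ℝ ∞ (fderiv ℝ (φ' ∘ φ.symm)) (φ.symm.trans φ').source :=
    hτ.fderiv_of_isOpen hopen (by simp)
  have hsub : ∀ q ∈ ((frameChart hπ hφ).symm.trans (frameChart hπ hφ')).source,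
      q.1 ∈ (φ.symm.trans φ').source := by
    intro q hq
    rw [source_frameChart_transition] at hq
    exact hq.1
  have hfst : ContDiffOn ℝ ∞
      (Prod.fst : EuclideanSpace ℝ (Fin (n + k)) × FrameModel n k → _)
      ((frameChart hπ hφ).symm.trans (frameChart hπ hφ')).source := contDiff_fst.contDiffOn
  have hsnd : ContDiffOn ℝ ∞
      (fun q : EuclideanSpace ℝ (Fin (n + k)) × FrameModel n k => ofBlocks q.2)
      ((frameChart hπ hφ).symm.trans (frameChart hπ hφ')).source :=
    ((LinearMap.toContinuousLinearMap (ofBlocks (n := n) (k := k))).contDiff.comp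
      contDiff_snd).contDiffOn
  have hmain : ContDiffOn ℝ ∞
      (fun q : EuclideanSpace ℝ (Fin (n + k)) × FrameModel n k =>
        ((φ' ∘ φ.symm) q.1, blocks ((fderiv ℝ (φ' ∘ φ.symm) q.1).comp (ofBlocks q.2))))
      ((frameChart hπ hφ).symm.trans (frameChart hπ hφ')).source :=
    (hτ.comp hfst hsub).prodMk
      ((LinearMap.toContinuousLinearMap (blocks (n := n) (k := k))).contDiff.comp_contDiffOn
        ((hτ'.comp hfst hsub).clm_comp hsnd))
  refine hmain.congr fun q hq => ?_
  obtain ⟨h1, h2⟩ := frameChart_transition hφ hφ' hq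
  exact Prod.ext h1 h2

theorem isOpen_source_frameChart_transition [IsManifold (𝓡 (n + k)) ∞ E] [IsManifold (𝓡 n) ∞ M]
    {φ φ' : OpenPartialHomeomorph E (EuclideanSpace ℝ (Fin (n + k)))} (hφ : IsAdaptedChart π φ)
    (hφ' : IsAdaptedChart π φ') :
    IsOpen ((frameChart hπ hφ).symm.trans (frameChart hπ hφ')).source := by
  rw [source_frameChart_transition]
  exact ((φ.symm.trans φ').open_source.preimage continuous_fst).inter
    (ContinuousLinearEquiv.isOpen.preimage
      ((LinearMap.toContinuousLinearMap (ofBlocks (n := n) (k := k))).continuous.comp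
        continuous_snd))

/-- The atlas of `L_π E` formed by the charts induced by the adapted charts of `E`. -/
noncomputable def chartedSpaceCore [IsManifold (𝓡 (n + k)) ∞ E] [IsManifold (𝓡 n) ∞ M]
    (hπ : Manifold.IsSubmersion (𝓡 (n + k)) (𝓡 n) ∞ π) :
    ChartedSpaceCore (EuclideanSpace ℝ (Fin (n + k)) × FrameModel n k)
      (AdaptedFrameBundle hπ) where
  atlas := {c | ∃ (φ : OpenPartialHomeomorph E (EuclideanSpace ℝ (Fin (n + k))))
    (hφ : IsAdaptedChart π φ), c = frameChart hπ hφ}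
  chartAt u := frameChart hπ (exists_isAdaptedChart hπ u.pt).choose_spec.1
  mem_chart_source u := (exists_isAdaptedChart hπ u.pt).choose_spec.2
  chart_mem_atlas u := ⟨_, _, rfl⟩
  open_source := by
    rintro _ _ ⟨φ, hφ, rfl⟩ ⟨φ', hφ', rfl⟩
    exact isOpen_source_frameChart_transition hφ hφ'
  continuousOn_toFun := by
    rintro _ _ ⟨φ, hφ, rfl⟩ ⟨φ', hφ', rfl⟩
    exact (contDiffOn_frameChart_transition hφ hφ').continuousOn

noncomputable instance [IsManifold (𝓡 (n + k)) ∞ E] [IsManifold (𝓡 n) ∞ M] :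
    TopologicalSpace (AdaptedFrameBundle hπ) :=
  (chartedSpaceCore hπ).toTopologicalSpace

noncomputable instance [IsManifold (𝓡 (n + k)) ∞ E] [IsManifold (𝓡 n) ∞ M] :
    ChartedSpace (EuclideanSpace ℝ (Fin (n + k)) × FrameModel n k) (AdaptedFrameBundle hπ) :=
  (chartedSpaceCore hπ).toChartedSpace

instance [IsManifold (𝓡 (n + k)) ∞ E] [IsManifold (𝓡 n) ∞ M] :
    IsManifold 𝓘(ℝ, EuclideanSpace ℝ (Fin (n + k)) × FrameModel n k) ∞
      (AdaptedFrameBundle hπ) := by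
  apply isManifold_of_contDiffOn
  intro e e' he he'
  obtain ⟨c, hc, rfl⟩ : ∃ c, ∃ h : c ∈ (chartedSpaceCore hπ).atlas,
      e = (chartedSpaceCore hπ).openPartialHomeomorph c h := by
    simpa [atlas, ChartedSpace.atlas, ChartedSpaceCore.toChartedSpace] using he
  obtain ⟨c', hc', rfl⟩ : ∃ c', ∃ h : c' ∈ (chartedSpaceCore hπ).atlas,
      e' = (chartedSpaceCore hπ).openPartialHomeomorph c' h := by
    simpa [atlas, ChartedSpace.atlas, ChartedSpaceCore.toChartedSpace] using he'
  obtain ⟨φ, hφ, rfl⟩ := id hc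
  obtain ⟨φ', hφ', rfl⟩ := id hc'
  exact (contDiffOn_frameChart_transition (hπ := hπ) hφ hφ').mono fun q hq => hq.1

/-! ### The structure group, fundamental vector fields, lifted Lagrangians -/

/-- The right action of an invertible block lower triangular matrix `g` on adapted frames:
`(u · g)_β = ∑ α, g_{αβ} u_α`. -/
noncomputable def act (u : AdaptedFrameBundle hπ) (g : Matrix (Fin n ⊕ Fin k) (Fin n ⊕ Fin k) ℝ)
    (hg : IsUnit g.det) (hg' : ∀ (i : Fin n) (A : Fin k), g (Sum.inl i) (Sum.inr A) = 0) :
    AdaptedFrameBundle hπ where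
  pt := u.pt
  frame := u.frame.map (Matrix.toLinearEquiv u.frame g hg)
  vertical A := by
    have h : (u.frame.map (Matrix.toLinearEquiv u.frame g hg)) (Sum.inr A) =
        ∑ B, g (Sum.inr B) (Sum.inr A) • u.frame (Sum.inr B) := by
      simp [Matrix.toLinearEquiv, Matrix.toLin_self, hg']
    rw [h, map_sum]
    exact Finset.sum_eq_zero fun B _ => by rw [map_smul, u.vertical B, smul_zero]

theorem exp_lower {ξ : Matrix (Fin n ⊕ Fin k) (Fin n ⊕ Fin k) ℝ}
    (hξ : ∀ (i : Fin n) (A : Fin k), ξ (Sum.inl i) (Sum.inr A) = 0) (t : ℝ)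
    (i : Fin n) (A : Fin k) :
    NormedSpace.exp (t • ξ) (Sum.inl i) (Sum.inr A) = 0 := by
  have h : (t • ξ).BlockTriangular (Sum.elim (fun _ : Fin n => (1 : ℕ)) (fun _ : Fin k => 0)) := by
    rintro (a | a) (b | b) hab <;> simp_all
  exact h.exp (by simp)

theorem isUnit_det_exp (ξ : Matrix (Fin n ⊕ Fin k) (Fin n ⊕ Fin k) ℝ) :
    IsUnit (NormedSpace.exp ξ).det :=
  (Matrix.isUnit_iff_isUnit_det _).1 (Matrix.isUnit_exp ξ)

/-- `ξ^*(L)(u)`: the derivative of the function `L` along the fundamental vertical vector field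
`ξ^*(u) = d/dt|_{t=0} u · exp (t ξ)` of an element `ξ` of the Lie algebra of block lower triangular
matrices. -/
noncomputable def fundamentalDeriv (ξ : Matrix (Fin n ⊕ Fin k) (Fin n ⊕ Fin k) ℝ)
    (hξ : ∀ (i : Fin n) (A : Fin k), ξ (Sum.inl i) (Sum.inr A) = 0)
    (L : AdaptedFrameBundle hπ → ℝ) (u : AdaptedFrameBundle hπ) : ℝ :=
  deriv (fun t : ℝ => L (u.act (NormedSpace.exp (t • ξ)) (isUnit_det_exp _) (exp_lower hξ t))) 0

/-- `E^{*i}_j(L)`. The matrix `E^i_j` has its single entry `1` in row `j` and column `i`, so that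
`E^{*i}_j` moves `e_i` in the direction `e_j`. -/
noncomputable def horizontalDeriv (i j : Fin n) (L : AdaptedFrameBundle hπ → ℝ) :
    AdaptedFrameBundle hπ → ℝ :=
  fundamentalDeriv (Matrix.single (Sum.inl j) (Sum.inl i) 1) (by simp) L

/-- `E^{*A}_B(L)`: the field `E^{*A}_B` moves `e_A` in the direction `e_B`. -/
noncomputable def verticalDeriv (A B : Fin k) (L : AdaptedFrameBundle hπ → ℝ) :
    AdaptedFrameBundle hπ → ℝ :=
  fundamentalDeriv (Matrix.single (Sum.inr B) (Sum.inr A) 1) (by simp) L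

/-- The covariant momenta `E^{*i}_A(L)`: the field `E^{*i}_A` moves `e_i` in the direction
`e_A`. -/
noncomputable def momentum (i : Fin n) (A : Fin k) (L : AdaptedFrameBundle hπ → ℝ) :
    AdaptedFrameBundle hπ → ℝ :=
  fundamentalDeriv (Matrix.single (Sum.inr A) (Sum.inl i) 1) (by simp) L

/-- A (smooth) lifted Lagrangian on `L_π E`. -/
structure IsLiftedLagrangian [IsManifold (𝓡 (n + k)) ∞ E] [IsManifold (𝓡 n) ∞ M]
    (L : AdaptedFrameBundle hπ → ℝ) : Prop where
  smooth : ContMDiff 𝓘(ℝ, EuclideanSpace ℝ (Fin (n + k)) × FrameModel n k) 𝓘(ℝ, ℝ) ∞ L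
  horizontalDeriv_eq_zero : ∀ i j u, horizontalDeriv i j L u = 0
  verticalDeriv_eq_zero : ∀ A B u, verticalDeriv A B L u = 0

/-! ### The soldering form and the Cartan-Hamilton-Poincaré forms -/

section

variable [IsManifold (𝓡 (n + k)) ∞ E] [IsManifold (𝓡 n) ∞ M]

/-- The `ℝ^{n+k}`-valued soldering form `θ = (θ^i, θ^A)`: the components with respect to the frame
`u` of the projection of a tangent vector to `E`. -/
noncomputable def soldering (u : AdaptedFrameBundle hπ) :
    TangentSpace 𝓘(ℝ, EuclideanSpace ℝ (Fin (n + k)) × FrameModel n k) u →L[ℝ]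
      (Fin n ⊕ Fin k → ℝ) :=
  (u.frameIso.symm : TangentSpace (𝓡 (n + k)) u.pt →L[ℝ] (Fin n ⊕ Fin k → ℝ)).comp
    (mfderiv 𝓘(ℝ, EuclideanSpace ℝ (Fin (n + k)) × FrameModel n k) (𝓡 (n + k))
      (AdaptedFrameBundle.pt : AdaptedFrameBundle hπ → E) u)

/-- The Cartan-Hamilton-Poincaré `1`-forms
`θ^i_L = τ L θ^i + ∑ A, E^{*i}_A(L) θ^A` and `θ^A_L = θ^A`,
combined to an `ℝ^{n+k}`-valued `1`-form. -/
noncomputable def chpForm (τ : ℝ) (L : AdaptedFrameBundle hπ → ℝ) (u : AdaptedFrameBundle hπ) :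
    TangentSpace 𝓘(ℝ, EuclideanSpace ℝ (Fin (n + k)) × FrameModel n k) u →L[ℝ]
      (Fin n ⊕ Fin k → ℝ) :=
  ContinuousLinearMap.pi (Sum.elim
    (fun i => (τ * L u) • (ContinuousLinearMap.proj (Sum.inl i)).comp (soldering u) +
      ∑ A, momentum i A L u • (ContinuousLinearMap.proj (Sum.inr A)).comp (soldering u))
    (fun A => (ContinuousLinearMap.proj (Sum.inr A)).comp (soldering u)))

end

end AdaptedFrameBundle

end

/-!
In an adapted chart, with base point `z` and frame matrix `V`, the soldering form is `θ = V⁻¹ dz`,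
and `ω = V⁻¹ dV` satisfies the structure equation `dθ = -ω ∧ θ`. The Cartan-Hamilton-Poincaré form
is `T θ` with `T = [[τ L, p], [0, 1]]`, so its differential is `dT ∧ θ - T ω ∧ θ`.

Let `X` be in the kernel of this two-form. Pairing `X` with the vertical vectors `V ξ`, where `ξ` is
the projection onto either block, annihilates first the vertical and then the horizontal components
of `θ(X)`. The second step divides by `L - ∑ i, E^{*i}_i(L)`, which equals `L` for a lifted
Lagrangian. Now `X` is vertical, and pairing it with the horizontal lifts of a basis yields
`ω(X) = s • [[1, 0], [0, 0]]` with `s = dL(X) / L`. Hence `dL(X) = s ∑ i, E^{*i}_i(L)`, that is,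
`s (L - ∑ i, E^{*i}_i(L)) = 0`, so `s = 0` and `X = 0`.
-/

namespace ManifoldForm

section

variable {F : Type*} [NormedAddCommGroup F] [NormedSpace ℝ F]
  {P : Type*} [TopologicalSpace P] [ChartedSpace F P]
  {W : Type*} [NormedAddCommGroup W] [NormedSpace ℝ W] {p : ℕ}
  {φ ψ : OpenPartialHomeomorph P F}

theorem minSmoothness_two_le_infty : minSmoothness ℝ 2 ≤ ∞ := by
  rw [minSmoothness_of_isRCLikeNormedField]
  exact WithTop.coe_le_coe.2 le_top

theorem IsSmooth.contDiffAt {α : ∀ u : P, TangentSpace 𝓘(ℝ, F) u [⋀^Fin p]→L[ℝ] W}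
    (hα : IsSmooth α) (hφ : φ ∈ atlas F P) {z : F} (hz : z ∈ φ.target) :
    ContDiffAt ℝ ∞ (inChart α φ) z :=
  (hα φ hφ).contDiffAt (φ.open_target.mem_nhds hz)

variable [IsManifold 𝓘(ℝ, F) ∞ P]

theorem contDiffOn_transition (hφ : φ ∈ atlas F P) (hψ : ψ ∈ atlas F P) :
    ContDiffOn ℝ ∞ (ψ ∘ φ.symm) (φ.symm.trans ψ).source :=
  contMDiffOn_iff_contDiffOn.1 (contMDiffOn_of_mem_contDiffGroupoid
    ((contDiffGroupoid ∞ 𝓘(ℝ, F)).compatible hφ hψ))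

theorem fderiv_transition (hφ : φ ∈ atlas F P) (hψ : ψ ∈ atlas F P) {z : F}
    (hz : z ∈ (φ.symm.trans ψ).source) :
    fderiv ℝ (ψ ∘ φ.symm) z =
      (mfderiv 𝓘(ℝ, F) 𝓘(ℝ, F) ψ (φ.symm z)).comp (mfderiv 𝓘(ℝ, F) 𝓘(ℝ, F) φ.symm z) := by
  rw [← mfderiv_eq_fderiv]
  exact mfderiv_comp z ((mdifferentiable_of_mem_atlas hψ).mdifferentiableAt hz.2)
    ((mdifferentiable_of_mem_atlas hφ).mdifferentiableAt_symm hz.1)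

theorem inChart_compContinuousLinearMap
    (α : ∀ u : P, TangentSpace 𝓘(ℝ, F) u [⋀^Fin p]→L[ℝ] W) (hφ : φ ∈ atlas F P) {u : P}
    (hu : u ∈ φ.source) :
    (inChart α φ (φ u)).compContinuousLinearMap
      (mfderiv 𝓘(ℝ, F) 𝓘(ℝ, F) φ u : TangentSpace 𝓘(ℝ, F) u →L[ℝ] F) = α u := by
  have transport (A : F →L[ℝ] F) {x : P} (hx : x = u) :
      (show F [⋀^Fin p]→L[ℝ] W from α x).compContinuousLinearMap A =
        (show F [⋀^Fin p]→L[ℝ] W from α u).compContinuousLinearMap A := by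
    rw [hx]
  refine (congrArg (fun β : F [⋀^Fin p]→L[ℝ] W => β.compContinuousLinearMap
    (mfderiv 𝓘(ℝ, F) 𝓘(ℝ, F) φ u : F →L[ℝ] F)) (transport _ (φ.left_inv hu))).trans ?_
  ext v
  exact congrArg (α u) (funext fun i =>
    congrArg (fun T => T (v i)) ((mdifferentiable_of_mem_atlas hφ).symm_comp_deriv hu))

theorem inChart_eq_pullback (α : ∀ u : P, TangentSpace 𝓘(ℝ, F) u [⋀^Fin p]→L[ℝ] W)
    (hφ : φ ∈ atlas F P) (hψ : ψ ∈ atlas F P) {z : F} (hz : z ∈ (φ.symm.trans ψ).source) :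
    inChart α φ z = (inChart α ψ ((ψ ∘ φ.symm) z)).compContinuousLinearMap
      (fderiv ℝ (ψ ∘ φ.symm) z) := by
  have hz' : φ.symm z ∈ ψ.source := hz.2
  rw [fderiv_transition hφ hψ hz, inChart, ← inChart_compContinuousLinearMap α hψ hz']
  rfl

theorem inChart_d {α : ∀ u : P, TangentSpace 𝓘(ℝ, F) u [⋀^Fin p]→L[ℝ] W} (hα : IsSmooth α)
    (hφ : φ ∈ atlas F P) {z : F} (hz : z ∈ φ.target) :
    inChart (d α) φ z = extDeriv (inChart α φ) z := by
  set ψ := chartAt F (φ.symm z)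
  have hψ : ψ ∈ atlas F P := chart_mem_atlas F (φ.symm z)
  have hz' : z ∈ (φ.symm.trans ψ).source := ⟨hz, mem_chart_source F (φ.symm z)⟩
  have hnhds := (φ.symm.trans ψ).open_source.mem_nhds hz'
  have hpullback : inChart α φ =ᶠ[𝓝 z] fun x =>
      (inChart α ψ ((ψ ∘ φ.symm) x)).compContinuousLinearMap (fderiv ℝ (ψ ∘ φ.symm) x) :=
    Filter.eventuallyEq_of_mem hnhds fun x hx => inChart_eq_pullback α hφ hψ hx
  have hdiff : DifferentiableAt ℝ (inChart α ψ) ((ψ ∘ φ.symm) z) :=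
    (hα.contDiffAt hψ (ψ.map_source hz'.2)).differentiableAt (by simp)
  rw [hpullback.extDeriv_eq,
    extDeriv_pullback hdiff ((contDiffOn_transition hφ hψ).contDiffAt hnhds)
      minSmoothness_two_le_infty,
    fderiv_transition hφ hψ hz']
  rfl

theorem IsSmooth.d {α : ∀ u : P, TangentSpace 𝓘(ℝ, F) u [⋀^Fin p]→L[ℝ] W} (hα : IsSmooth α) :
    IsSmooth (d α) := fun φ hφ => by
  have hext : ContDiffOn ℝ ∞ (extDeriv (inChart α φ)) φ.target :=
    (ContinuousAlternatingMap.alternatizeUncurryFinCLM ℝ F W).contDiff.comp_contDiffOn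
      ((hα φ hφ).fderiv_of_isOpen φ.open_target (by simp))
  exact hext.congr fun _ hz => inChart_d hα hφ hz

theorem IsSmooth.d_d {α : ∀ u : P, TangentSpace 𝓘(ℝ, F) u [⋀^Fin p]→L[ℝ] W} (hα : IsSmooth α)
    (u : P) : ManifoldForm.d (ManifoldForm.d α) u = 0 := by
  have hφ := chart_mem_atlas F u
  have hu := (chartAt F u).map_source (mem_chart_source F u)
  have hd : inChart (ManifoldForm.d α) (chartAt F u) =ᶠ[𝓝 (chartAt F u u)]
      extDeriv (inChart α (chartAt F u)) :=
    Filter.eventuallyEq_of_mem ((chartAt F u).open_target.mem_nhds hu) fun _ hz =>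
      inChart_d hα hφ hz
  rw [ManifoldForm.d, hd.extDeriv_eq,
    extDeriv_extDeriv_apply (hα.contDiffAt hφ hu) minSmoothness_two_le_infty]
  rfl

theorem d_nondegenerate {α : ∀ u : P, TangentSpace 𝓘(ℝ, F) u [⋀^Fin 1]→L[ℝ] W}
    (h : ∀ φ ∈ atlas F P, ∀ z ∈ φ.target, ∀ X : F,
      (∀ Y : F, extDeriv (inChart α φ) z ![X, Y] = 0) → X = 0)
    (u : P) (X : TangentSpace 𝓘(ℝ, F) u) :
    (∀ Y : TangentSpace 𝓘(ℝ, F) u, ManifoldForm.d α u ![X, Y] = 0) ↔ X = 0 := by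
  have hu := mem_chart_source F u
  let D := (mdifferentiable_of_mem_atlas (I := 𝓘(ℝ, F)) (chart_mem_atlas F u)).mfderiv hu
  have d_eq (Y) : ManifoldForm.d α u ![X, Y] =
      extDeriv (inChart α (chartAt F u)) (chartAt F u u) ![D X, D Y] :=
    congrArg (extDeriv _ _) (funext (Fin.forall_fin_two.2 ⟨rfl, rfl⟩))
  refine ⟨fun hX => D.injective ?_, ?_⟩
  · rw [map_zero]
    refine h _ (chart_mem_atlas F u) _ ((chartAt F u).map_source hu) _ fun Y => ?_
    obtain ⟨Y, rfl⟩ := D.surjective Y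
    exact (d_eq Y).symm.trans (hX Y)
  · rintro rfl Y
    exact (ManifoldForm.d α u).map_coord_zero 0 rfl

end

theorem extDeriv_ofSubsingleton_apply {F W : Type*} [NormedAddCommGroup F] [NormedSpace ℝ F]
    [NormedAddCommGroup W] [NormedSpace ℝ W] {Θ : F → F →L[ℝ] W} {z : F}
    (hΘ : DifferentiableAt ℝ Θ z) (X Y : F) :
    extDeriv (fun z => ContinuousAlternatingMap.ofSubsingleton ℝ F W (0 : Fin 1) (Θ z)) z ![X, Y] =
      fderiv ℝ Θ z X Y - fderiv ℝ Θ z Y X := by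
  have hd : DifferentiableAt ℝ
      (fun z => ContinuousAlternatingMap.ofSubsingleton ℝ F W (0 : Fin 1) (Θ z)) z :=
    ((ContinuousAlternatingMap.ofSubsingletonLIE (𝕜 := ℝ) (E := F) (F := W)
      (0 : Fin 1)).differentiable (Θ z)).comp z hΘ
  have fderiv_apply (U V : F) : fderiv ℝ (fun z => Θ z U) z V = fderiv ℝ Θ z V U := by
    simp [fderiv_clm_apply hΘ (differentiableAt_const U)]
  rw [extDeriv_apply hd, Fin.sum_univ_two]
  simp [Fin.removeNth, fderiv_apply, sub_eq_add_neg]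

end ManifoldForm

theorem fderiv_continuousLinearMap_inverse {𝕜 E F : Type*} [NontriviallyNormedField 𝕜]
    [NormedAddCommGroup E] [NormedSpace 𝕜 E] [NormedAddCommGroup F] [NormedSpace 𝕜 F]
    [CompleteSpace E] {T : E →L[𝕜] F} (hT : T.IsInvertible) (V : E →L[𝕜] F) :
    fderiv 𝕜 ContinuousLinearMap.inverse T V = -(T.inverse ∘L V ∘L T.inverse) := by
  have hd : DifferentiableAt 𝕜 ContinuousLinearMap.inverse T := by
    obtain ⟨e, rfl⟩ := hT
    exact (contDiffAt_map_inverse (n := 1) e).differentiableAt one_ne_zero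
  have hone : (fun S : E →L[𝕜] F => S.inverse ∘L S) =ᶠ[𝓝 T] fun _ => .id 𝕜 E :=
    Filter.eventuallyEq_of_mem (ContinuousLinearEquiv.isOpen.mem_nhds hT) fun _ hS =>
      ContinuousLinearMap.IsInvertible.inverse_comp_self hS
  have hleibniz := (hd.hasFDerivAt.clm_comp (hasFDerivAt_id T)).unique
    ((hasFDerivAt_const _ T).congr_of_eventuallyEq hone)
  ext y
  have hy := congrArg (fun D => D V (T.inverse y)) hleibniz
  simp only [ContinuousLinearMap.comp_id, id_eq, add_apply, ContinuousLinearMap.compL_apply,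
    ContinuousLinearMap.comp_apply, ContinuousLinearMap.flip_apply, hT.self_apply_inverse,
    zero_apply] at hy
  simpa using eq_neg_of_add_eq_zero_right hy

section

attribute [local instance] Matrix.linftyOpNormedRing Matrix.linftyOpNormedAlgebra

theorem hasDerivAt_linearMap_exp_smul {W : Type*} [NormedAddCommGroup W] [NormedSpace ℝ W]
    {ι : Type*} [Fintype ι] [DecidableEq ι] (f : Matrix ι ι ℝ →ₗ[ℝ] W) (ξ : Matrix ι ι ℝ) :
    HasDerivAt (fun t : ℝ => f (NormedSpace.exp (t • ξ))) (f ξ) 0 := by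
  have hexp := hasDerivAt_exp_smul_const (𝕂 := ℝ) ξ (0 : ℝ)
  rw [zero_smul, NormedSpace.exp_zero, one_mul] at hexp
  exact (LinearMap.toContinuousLinearMap f).hasFDerivAt.comp_hasDerivAt (0 : ℝ) hexp

end

namespace AdaptedFrameBundle

/-- The endomorphism of `ℝ^ι` given by a matrix. -/
noncomputable def matrixCLM {ι : Type*} [Fintype ι] [DecidableEq ι] :
    Matrix ι ι ℝ →ₗ[ℝ] (ι → ℝ) →L[ℝ] (ι → ℝ) :=
  LinearMap.toContinuousLinearMap.toLinearMap ∘ₗ Matrix.toLin'.toLinearMap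

theorem matrixCLM_apply {ι : Type*} [Fintype ι] [DecidableEq ι] (ξ : Matrix ι ι ℝ) (w : ι → ℝ) :
    matrixCLM ξ w = ξ.mulVec w := rfl

theorem matrixCLM_one {ι : Type*} [Fintype ι] [DecidableEq ι] :
    matrixCLM (1 : Matrix ι ι ℝ) = .id ℝ (ι → ℝ) := by
  ext w
  simp [matrixCLM_apply]

variable {n k : ℕ}

variable (n k) in
/-- The model space of `L_π E`: a point `q` is a pair consisting of a base point in `ℝ^{n+k}` and
the blocks of an adapted frame at it. -/
abbrev Model : Type := EuclideanSpace ℝ (Fin (n + k)) × FrameModel n k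

/-- The coordinate expression `V ξ` of the fundamental vertical vector field of `ξ`, at the frame
with blocks `b` and matrix `V`. -/
noncomputable def verticalDir (b : FrameModel n k) :
    Matrix (Fin n ⊕ Fin k) (Fin n ⊕ Fin k) ℝ →ₗ[ℝ] FrameModel n k :=
  blocks ∘ₗ (ContinuousLinearMap.compL ℝ _ _ _ (ofBlocks b)).toLinearMap ∘ₗ matrixCLM

theorem verticalDir_apply (b : FrameModel n k) (ξ : Matrix (Fin n ⊕ Fin k) (Fin n ⊕ Fin k) ℝ) :
    verticalDir b ξ = blocks ((ofBlocks b).comp (matrixCLM ξ)) := rfl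

theorem verticalDir_one (b : FrameModel n k) : verticalDir b 1 = b := by
  rw [verticalDir_apply, matrixCLM_one, ContinuousLinearMap.comp_id, blocks_ofBlocks]

theorem ofBlocks_verticalDir (b : FrameModel n k) {ξ : Matrix (Fin n ⊕ Fin k) (Fin n ⊕ Fin k) ℝ}
    (hξ : ∀ (i : Fin n) (A : Fin k), ξ (Sum.inl i) (Sum.inr A) = 0) :
    ofBlocks (verticalDir b ξ) = (ofBlocks b).comp (matrixCLM ξ) := by
  rw [verticalDir_apply]
  refine ofBlocks_blocks fun A i => ?_
  rw [ContinuousLinearMap.comp_apply, ofBlocks_castAdd, matrixCLM_apply, Matrix.mulVec_single_one]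
  exact Finset.sum_eq_zero fun j _ => by rw [Matrix.col_apply, hξ, mul_zero]

theorem eq_zero_of_ofBlocks_castAdd_eq_zero {b : FrameModel n k}
    (hb : (ofBlocks b).IsInvertible) {w : Fin n ⊕ Fin k → ℝ}
    (hw : ∀ i : Fin n, ofBlocks b w (Fin.castAdd k i) = 0) (i : Fin n) : w (Sum.inl i) = 0 := by
  let T : (Fin n → ℝ) →ₗ[ℝ] (Fin n → ℝ) := Matrix.toLin' (b.1 : Matrix (Fin n) (Fin n) ℝ)
  have T_apply (v : Fin n ⊕ Fin k → ℝ) (i : Fin n) :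
      T (fun j => v (Sum.inl j)) i = ofBlocks b v (Fin.castAdd k i) := by
    rw [ofBlocks_castAdd]
    rfl
  have T_surjective : Function.Surjective T := fun z => by
    obtain ⟨v, hv⟩ := hb.surjective (WithLp.toLp 2 (Fin.addCases z 0))
    exact ⟨fun j => v (Sum.inl j), funext fun i => by simp [T_apply, hv]⟩
  have hTw : T (fun j => w (Sum.inl j)) = T 0 := funext fun i => by simp [T_apply, hw]
  exact congrFun (LinearMap.injective_iff_surjective.2 T_surjective hTw) i

/-- The inverse `V⁻¹` of the matrix of frame components, whose rows are the components of the dual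
coframe; it is `0` where `V` is not invertible. -/
noncomputable def coframe (q : Model n k) :
    EuclideanSpace ℝ (Fin (n + k)) →L[ℝ] (Fin n ⊕ Fin k → ℝ) :=
  (ofBlocks q.2).inverse

/-- The coordinate expression `V⁻¹ dz` of the soldering form. -/
noncomputable def localSoldering (q : Model n k) : Model n k →L[ℝ] (Fin n ⊕ Fin k → ℝ) :=
  (coframe q).comp (ContinuousLinearMap.fst ℝ _ _)

/-- The flat connection form `V⁻¹ dV` of the coordinates, evaluated at the tangent vector `X`. -/
noncomputable def localConnection (q X : Model n k) :
    (Fin n ⊕ Fin k → ℝ) →L[ℝ] (Fin n ⊕ Fin k → ℝ) :=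
  (coframe q).comp (ofBlocks X.2)

theorem localSoldering_apply (q Y : Model n k) : localSoldering q Y = coframe q Y.1 := rfl

theorem localConnection_apply (q X : Model n k) (w : Fin n ⊕ Fin k → ℝ) :
    localConnection q X w = coframe q (ofBlocks X.2 w) := rfl

theorem contDiff_ofBlocks_snd : ContDiff ℝ ∞ (fun q : Model n k => ofBlocks q.2) :=
  (LinearMap.toContinuousLinearMap (ofBlocks (n := n) (k := k))).contDiff.comp contDiff_snd

section

variable {q : Model n k}

theorem contDiffAt_coframe (hq : (ofBlocks q.2).IsInvertible) : ContDiffAt ℝ ∞ coframe q := by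
  obtain ⟨e, he⟩ := hq
  have hinv := contDiffAt_map_inverse (𝕜 := ℝ) (n := ∞) e
  rw [he] at hinv
  exact hinv.comp q contDiff_ofBlocks_snd.contDiffAt

theorem contDiffAt_localSoldering (hq : (ofBlocks q.2).IsInvertible) :
    ContDiffAt ℝ ∞ localSoldering q :=
  (contDiffAt_coframe hq).clm_comp contDiffAt_const

theorem fderiv_coframe (hq : (ofBlocks q.2).IsInvertible) (X : Model n k) :
    fderiv ℝ coframe q X = -(localConnection q X).comp (coframe q) := by
  obtain ⟨e, he⟩ := id hq
  have hinv := (contDiffAt_map_inverse (𝕜 := ℝ) (n := 1) e).differentiableAt one_ne_zero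
  rw [he] at hinv
  have hV : HasFDerivAt (fun q : Model n k => ofBlocks q.2) _ q :=
    (LinearMap.toContinuousLinearMap (ofBlocks (n := n) (k := k))).hasFDerivAt.comp q
      hasFDerivAt_snd
  have hcoframe : HasFDerivAt coframe _ q := hinv.hasFDerivAt.comp q hV
  rw [hcoframe.fderiv]
  exact fderiv_continuousLinearMap_inverse hq _

theorem fderiv_localSoldering (hq : (ofBlocks q.2).IsInvertible) (X Y : Model n k) :
    fderiv ℝ localSoldering q X Y = -localConnection q X (localSoldering q Y) := by
  have h := ((contDiffAt_coframe hq).differentiableAt (by simp)).hasFDerivAt.clm_comp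
    (hasFDerivAt_const (ContinuousLinearMap.fst ℝ (EuclideanSpace ℝ (Fin (n + k)))
      (FrameModel n k)) q)
  have h' : HasFDerivAt localSoldering _ q := h
  simp [h'.fderiv, fderiv_coframe hq, localSoldering_apply]

theorem extDeriv_comp_localSoldering {W : Type*} [NormedAddCommGroup W] [NormedSpace ℝ W]
    {T : Model n k → (Fin n ⊕ Fin k → ℝ) →L[ℝ] W} (hq : (ofBlocks q.2).IsInvertible)
    (hT : DifferentiableAt ℝ T q) (X Y : Model n k) :
    extDeriv (fun q => ContinuousAlternatingMap.ofSubsingleton ℝ (Model n k) W (0 : Fin 1)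
        ((T q).comp (localSoldering q))) q ![X, Y] =
      fderiv ℝ T q X (localSoldering q Y) - fderiv ℝ T q Y (localSoldering q X) -
        T q (localConnection q X (localSoldering q Y) -
          localConnection q Y (localSoldering q X)) := by
  have hθ := (contDiffAt_localSoldering hq).differentiableAt (by simp)
  have hTθ := hT.hasFDerivAt.clm_comp hθ.hasFDerivAt
  rw [ManifoldForm.extDeriv_ofSubsingleton_apply hTθ.differentiableAt, hTθ.fderiv]
  simp only [add_apply, ContinuousLinearMap.comp_apply, ContinuousLinearMap.compL_apply,
    ContinuousLinearMap.flip_apply, fderiv_localSoldering hq, map_neg, map_sub]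
  abel

theorem localConnection_verticalDir (hq : (ofBlocks q.2).IsInvertible)
    {ξ : Matrix (Fin n ⊕ Fin k) (Fin n ⊕ Fin k) ℝ}
    (hξ : ∀ (i : Fin n) (A : Fin k), ξ (Sum.inl i) (Sum.inr A) = 0) :
    localConnection q (0, verticalDir q.2 ξ) = matrixCLM ξ := by
  rw [localConnection, ofBlocks_verticalDir _ hξ, ← ContinuousLinearMap.comp_assoc, coframe,
    hq.inverse_comp_self, ContinuousLinearMap.id_comp]

theorem eq_verticalDir_of_localConnection_eq (hq : (ofBlocks q.2).IsInvertible) {X : Model n k}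
    {ξ : Matrix (Fin n ⊕ Fin k) (Fin n ⊕ Fin k) ℝ} (hX : localConnection q X = matrixCLM ξ) :
    X.2 = verticalDir q.2 ξ := by
  rw [verticalDir_apply, ← hX, localConnection, ← ContinuousLinearMap.comp_assoc, coframe,
    hq.self_comp_inverse, ContinuousLinearMap.id_comp, blocks_ofBlocks]

theorem localConnection_apply_inl_eq_zero (hq : (ofBlocks q.2).IsInvertible) (X : Model n k)
    {w : Fin n ⊕ Fin k → ℝ} (hw : ∀ i, w (Sum.inl i) = 0) (i : Fin n) :
    localConnection q X w (Sum.inl i) = 0 :=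
  eq_zero_of_ofBlocks_castAdd_eq_zero hq (fun j => by
    rw [localConnection_apply, coframe, hq.self_apply_inverse, ofBlocks_castAdd]
    simp [hw]) i

end

variable (n k) in
/-- The matrix `[[c, p], [0, 0]]` as a linear function of `m = (c, p)`. -/
noncomputable def horizontalBlock :
    ℝ × (Fin n → Fin k → ℝ) →ₗ[ℝ] (Fin n ⊕ Fin k → ℝ) →L[ℝ] (Fin n ⊕ Fin k → ℝ) where
  toFun m := matrixCLM (Matrix.fromBlocks (m.1 • 1) (Matrix.of m.2) 0 0)
  map_add' m m' := by
    rw [← map_add, Matrix.fromBlocks_add, Prod.fst_add, add_smul, Prod.snd_add, Matrix.of_add_of,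
      add_zero, add_zero]
  map_smul' c m := by
    rw [← map_smul, Matrix.fromBlocks_smul, Prod.smul_fst, smul_assoc, Prod.smul_snd,
      Matrix.smul_of, smul_zero, smul_zero, RingHom.id_apply]

theorem horizontalBlock_apply_inl (m : ℝ × (Fin n → Fin k → ℝ)) (w : Fin n ⊕ Fin k → ℝ)
    (i : Fin n) :
    horizontalBlock n k m w (Sum.inl i) = m.1 * w (Sum.inl i) + ∑ A, m.2 i A * w (Sum.inr A) := by
  simp [horizontalBlock, matrixCLM_apply, Matrix.mulVec, dotProduct, Matrix.one_apply]

theorem horizontalBlock_apply_inr (m : ℝ × (Fin n → Fin k → ℝ)) (w : Fin n ⊕ Fin k → ℝ)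
    (A : Fin k) : horizontalBlock n k m w (Sum.inr A) = 0 := by
  simp [horizontalBlock, matrixCLM_apply, Matrix.fromBlocks_mulVec]

/-- The coefficient matrix `T = [[c, p], [0, 1]]` of the Cartan-Hamilton-Poincaré form, where
`m = (c, p)` consists of the multiple `c = τ L` of the Lagrangian and of the momenta `p`. -/
noncomputable def chpMatrix (m : ℝ × (Fin n → Fin k → ℝ)) :
    (Fin n ⊕ Fin k → ℝ) →L[ℝ] (Fin n ⊕ Fin k → ℝ) :=
  matrixCLM (Matrix.fromBlocks 0 0 0 1) + horizontalBlock n k m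

theorem chpMatrix_apply_inl (m : ℝ × (Fin n → Fin k → ℝ)) (w : Fin n ⊕ Fin k → ℝ) (i : Fin n) :
    chpMatrix m w (Sum.inl i) = m.1 * w (Sum.inl i) + ∑ A, m.2 i A * w (Sum.inr A) := by
  simp [chpMatrix, matrixCLM_apply, Matrix.fromBlocks_mulVec, horizontalBlock_apply_inl]

theorem chpMatrix_apply_inr (m : ℝ × (Fin n → Fin k → ℝ)) (w : Fin n ⊕ Fin k → ℝ) (A : Fin k) :
    chpMatrix m w (Sum.inr A) = w (Sum.inr A) := by
  simp [chpMatrix, matrixCLM_apply, Matrix.fromBlocks_mulVec, horizontalBlock_apply_inr]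

/-- The coordinate expression `T θ` of the Cartan-Hamilton-Poincaré form. -/
noncomputable def localForm (m : Model n k → ℝ × (Fin n → Fin k → ℝ)) (q : Model n k) :
    Model n k →L[ℝ] (Fin n ⊕ Fin k → ℝ) :=
  (chpMatrix (m q)).comp (localSoldering q)

/-- The coordinate expression `dT ∧ θ - T ω ∧ θ` of the exterior derivative of the
Cartan-Hamilton-Poincaré form, given by the structure equation `dθ = -ω ∧ θ`. -/
noncomputable def localTwoForm (m : Model n k → ℝ × (Fin n → Fin k → ℝ)) (q X Y : Model n k) :
    Fin n ⊕ Fin k → ℝ :=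
  horizontalBlock n k (fderiv ℝ m q X) (localSoldering q Y) -
    horizontalBlock n k (fderiv ℝ m q Y) (localSoldering q X) -
    chpMatrix (m q) (localConnection q X (localSoldering q Y) -
      localConnection q Y (localSoldering q X))

section

variable {m : Model n k → ℝ × (Fin n → Fin k → ℝ)} {q X Y : Model n k}

theorem contDiffOn_localForm {U : Set (Model n k)} (hU : ∀ q ∈ U, (ofBlocks q.2).IsInvertible)
    (hm : ContDiffOn ℝ ∞ m U) : ContDiffOn ℝ ∞ (localForm m) U :=
  (contDiffOn_const.add
    ((LinearMap.toContinuousLinearMap (horizontalBlock n k)).contDiff.comp_contDiffOn hm)).clm_comp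
      fun q hq => (contDiffAt_localSoldering (hU q hq)).contDiffWithinAt

theorem extDeriv_localForm (hq : (ofBlocks q.2).IsInvertible) (hm : DifferentiableAt ℝ m q) :
    extDeriv (fun q => ContinuousAlternatingMap.ofSubsingleton ℝ (Model n k)
      (Fin n ⊕ Fin k → ℝ) (0 : Fin 1) (localForm m q)) q ![X, Y] = localTwoForm m q X Y := by
  have hT : HasFDerivAt (fun q => chpMatrix (m q)) _ q :=
    ((LinearMap.toContinuousLinearMap (horizontalBlock n k)).hasFDerivAt.comp q
      hm.hasFDerivAt).const_add (matrixCLM (Matrix.fromBlocks 0 0 0 1))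
  have hstructure := extDeriv_comp_localSoldering hq hT.differentiableAt X Y
  rw [hT.fderiv] at hstructure
  exact hstructure

theorem localTwoForm_apply_inr (A : Fin k) :
    localTwoForm m q X Y (Sum.inr A) =
      localConnection q Y (localSoldering q X) (Sum.inr A) -
        localConnection q X (localSoldering q Y) (Sum.inr A) := by
  simp [localTwoForm, horizontalBlock_apply_inr, chpMatrix_apply_inr]

theorem localTwoForm_apply_inl_of_eq_zero (hXY : ∀ A, localTwoForm m q X Y (Sum.inr A) = 0)
    (hX : ∀ A, localSoldering q X (Sum.inr A) = 0) (hY : ∀ A, localSoldering q Y (Sum.inr A) = 0)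
    (i : Fin n) :
    localTwoForm m q X Y (Sum.inl i) =
      (fderiv ℝ m q X).1 * localSoldering q Y (Sum.inl i) -
        (fderiv ℝ m q Y).1 * localSoldering q X (Sum.inl i) -
        (m q).1 * (localConnection q X (localSoldering q Y) (Sum.inl i) -
          localConnection q Y (localSoldering q X) (Sum.inl i)) := by
  have hconn (A : Fin k) : localConnection q X (localSoldering q Y) (Sum.inr A) =
      localConnection q Y (localSoldering q X) (Sum.inr A) :=
    (sub_eq_zero.1 ((localTwoForm_apply_inr A).symm.trans (hXY A))).symm
  simp [localTwoForm, horizontalBlock_apply_inl, chpMatrix_apply_inl, hX, hY, hconn,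
    mul_sub]

theorem localSoldering_vertical (V : FrameModel n k) : localSoldering q (0, V) = 0 :=
  map_zero (coframe q)

theorem localSoldering_inr_eq_zero (hq : (ofBlocks q.2).IsInvertible)
    (hX : ∀ Y, localTwoForm m q X Y = 0) (A : Fin k) : localSoldering q X (Sum.inr A) = 0 := by
  have hA := congrFun (hX (0, verticalDir q.2 (Matrix.fromBlocks 0 0 0 1))) (Sum.inr A)
  rw [localTwoForm_apply_inr, localConnection_verticalDir hq (by simp),
    localSoldering_vertical] at hA
  simpa [matrixCLM_apply, Matrix.fromBlocks_mulVec] using hA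

theorem localSoldering_eq_zero (hq : (ofBlocks q.2).IsInvertible)
    (hD : (fderiv ℝ m q (0, verticalDir q.2 (Matrix.fromBlocks 1 0 0 0))).1 ≠ (m q).1)
    (hX : ∀ Y, localTwoForm m q X Y = 0) : localSoldering q X = 0 := by
  funext a
  rcases a with i | A
  · have hi := congrFun (hX (0, verticalDir q.2 (Matrix.fromBlocks 1 0 0 0))) (Sum.inl i)
    rw [localTwoForm_apply_inl_of_eq_zero (congrFun (hX _) <| .inr ·)
      (localSoldering_inr_eq_zero hq hX) (by simp [localSoldering_vertical]),
      localConnection_verticalDir hq (by simp), localSoldering_vertical] at hi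
    have hmul : ((m q).1 - (fderiv ℝ m q (0, verticalDir q.2 (Matrix.fromBlocks 1 0 0 0))).1) *
        localSoldering q X (Sum.inl i) = 0 := by
      simp only [Pi.zero_apply, mul_zero, zero_sub, map_zero, matrixCLM_apply,
        Matrix.fromBlocks_mulVec, Matrix.one_mulVec, Matrix.zero_mulVec, add_zero, Sum.elim_inl,
        Function.comp_apply] at hi
      linear_combination hi
    exact (mul_eq_zero.1 hmul).resolve_left (sub_ne_zero.2 hD.symm)
  · exact localSoldering_inr_eq_zero hq hX A

theorem localConnection_eq_smul (hq : (ofBlocks q.2).IsInvertible) (hc : (m q).1 ≠ 0)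
    (hθ : localSoldering q X = 0) (hX : ∀ Y, localTwoForm m q X Y = 0) :
    localConnection q X =
      matrixCLM (((fderiv ℝ m q X).1 / (m q).1) • Matrix.fromBlocks 1 0 0 0) := by
  have hsoldering (w : Fin n ⊕ Fin k → ℝ) : localSoldering q (ofBlocks q.2 w, 0) = w :=
    hq.inverse_apply_self w
  ext w a
  rw [map_smul]
  rcases a with i | A
  · set w' : Fin n ⊕ Fin k → ℝ := Sum.elim (fun j => w (Sum.inl j)) 0
    have hw' : localConnection q X w (Sum.inl i) = localConnection q X w' (Sum.inl i) := by
      have h := localConnection_apply_inl_eq_zero hq X (w := w - w') (by simp [w']) i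
      rwa [map_sub, Pi.sub_apply, sub_eq_zero] at h
    have hi := congrFun (hX (ofBlocks q.2 w', 0)) (Sum.inl i)
    rw [localTwoForm_apply_inl_of_eq_zero (congrFun (hX _) <| .inr ·) (by simp [hθ])
      (by simp [hsoldering, w']), hsoldering, hθ] at hi
    simp only [w', Sum.elim_inl, Pi.zero_apply, mul_zero, sub_zero, map_zero, smul_apply,
      matrixCLM_apply, Matrix.fromBlocks_mulVec, Matrix.one_mulVec, Matrix.zero_mulVec, add_zero,
      Pi.smul_apply, Function.comp_apply, smul_eq_mul] at hi ⊢
    rw [hw']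
    field_simp
    linear_combination -hi
  · have hA := congrFun (hX (ofBlocks q.2 w, 0)) (Sum.inr A)
    rw [localTwoForm_apply_inr, hsoldering, hθ] at hA
    simpa [matrixCLM_apply, Matrix.fromBlocks_mulVec] using hA

theorem localTwoForm_nondegenerate (hq : (ofBlocks q.2).IsInvertible) (hc : (m q).1 ≠ 0)
    (hD : (fderiv ℝ m q (0, verticalDir q.2 (Matrix.fromBlocks 1 0 0 0))).1 ≠ (m q).1)
    (hX : ∀ Y, localTwoForm m q X Y = 0) : X = 0 := by
  have hθ := localSoldering_eq_zero hq hD hX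
  have hbase : X.1 = 0 := by
    rw [← hq.self_apply_inverse X.1]
    exact (congrArg (ofBlocks q.2) hθ).trans (map_zero _)
  set s := (fderiv ℝ m q X).1 / (m q).1 with hs
  have hXs : X = s • (0, verticalDir q.2 (Matrix.fromBlocks 1 0 0 0)) := by
    refine Prod.ext (by simp [hbase]) ?_
    rw [eq_verticalDir_of_localConnection_eq hq (localConnection_eq_smul hq hc hθ hX), map_smul]
    rfl
  have hsD : s * ((m q).1 -
      (fderiv ℝ m q (0, verticalDir q.2 (Matrix.fromBlocks 1 0 0 0))).1) = 0 := by
    have h := congrArg (fun Z => (fderiv ℝ m q Z).1) hXs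
    simp only [map_smul, Prod.smul_fst, smul_eq_mul] at h
    rw [mul_sub, ← h, hs, div_mul_cancel₀ _ hc, sub_self]
  rw [hXs, (mul_eq_zero.1 hsD).resolve_right (sub_ne_zero.2 hD.symm), zero_smul]

end

variable {M : Type*} [TopologicalSpace M] [ChartedSpace (EuclideanSpace ℝ (Fin n)) M]
  {E : Type*} [TopologicalSpace E] [ChartedSpace (EuclideanSpace ℝ (Fin (n + k))) E]
  {π : E → M} {hπ : Manifold.IsSubmersion (𝓡 (n + k)) (𝓡 n) ∞ π}
  {φ : OpenPartialHomeomorph E (EuclideanSpace ℝ (Fin (n + k)))}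

theorem velocity_single (u : AdaptedFrameBundle hπ) (a : Fin n ⊕ Fin k) :
    velocity φ u (Pi.single a 1) = chartDeriv φ u.pt (u.frame a) :=
  congrArg (chartDeriv φ u.pt) (frameIso_single u a)

theorem act_frame (u : AdaptedFrameBundle hπ) {g : Matrix (Fin n ⊕ Fin k) (Fin n ⊕ Fin k) ℝ}
    (hg : IsUnit g.det) (hg' : ∀ (i : Fin n) (A : Fin k), g (Sum.inl i) (Sum.inr A) = 0)
    (a : Fin n ⊕ Fin k) : (u.act g hg hg').frame a = ∑ b, g b a • u.frame b := by
  change (u.frame.map (Matrix.toLinearEquiv u.frame g hg)) a = _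
  simp [Matrix.toLinearEquiv, Matrix.toLin_self]

theorem velocity_act (u : AdaptedFrameBundle hπ) {g : Matrix (Fin n ⊕ Fin k) (Fin n ⊕ Fin k) ℝ}
    (hg : IsUnit g.det) (hg' : ∀ (i : Fin n) (A : Fin k), g (Sum.inl i) (Sum.inr A) = 0) :
    velocity φ (u.act g hg hg') = (velocity φ u).comp (matrixCLM g) := by
  apply ContinuousLinearMap.coe_injective
  refine (Pi.basisFun ℝ (Fin n ⊕ Fin k)).ext fun a => ?_
  have hg_single : matrixCLM g (Pi.single a 1) = ∑ b, g b a • Pi.single b (1 : ℝ) := by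
    ext c
    simp [matrixCLM_apply, Pi.single_apply]
  have hcolumn : velocity φ (u.act g hg hg') (Pi.single a 1) =
      velocity φ u (matrixCLM g (Pi.single a 1)) := by
    rw [velocity_single, hg_single]
    refine (congrArg (chartDeriv φ u.pt) (act_frame u hg hg' a)).trans ?_
    simp only [map_sum, map_smul, velocity_single]
  simpa using hcolumn

variable [IsManifold (𝓡 (n + k)) ∞ E] [IsManifold (𝓡 n) ∞ M]

theorem coord_act (hφ : IsAdaptedChart π φ) {u : AdaptedFrameBundle hπ} (hu : u.pt ∈ φ.source)
    {g : Matrix (Fin n ⊕ Fin k) (Fin n ⊕ Fin k) ℝ} (hg : IsUnit g.det)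
    (hg' : ∀ (i : Fin n) (A : Fin k), g (Sum.inl i) (Sum.inr A) = 0) :
    coord φ (u.act g hg hg') = ((coord φ u).1, verticalDir (coord φ u).2 g) := by
  rw [verticalDir_apply, ofBlocks_coord hφ u hu, ← velocity_act u hg hg']
  rfl

/-- The chart of the manifold `L_π E` induced by an adapted chart of `E`, as a member of the
atlas. -/
noncomputable def inducedChart (hπ : Manifold.IsSubmersion (𝓡 (n + k)) (𝓡 n) ∞ π)
    (hφ : IsAdaptedChart π φ) : OpenPartialHomeomorph (AdaptedFrameBundle hπ) (Model n k) :=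
  (chartedSpaceCore hπ).openPartialHomeomorph (frameChart hπ hφ) ⟨φ, hφ, rfl⟩

theorem mem_atlas_iff {c : OpenPartialHomeomorph (AdaptedFrameBundle hπ) (Model n k)} :
    c ∈ atlas (Model n k) (AdaptedFrameBundle hπ) ↔
      ∃ (φ : OpenPartialHomeomorph E (EuclideanSpace ℝ (Fin (n + k))))
        (hφ : IsAdaptedChart π φ), c = inducedChart hπ hφ := by
  have hcore : c ∈ atlas (Model n k) (AdaptedFrameBundle hπ) ↔
      ∃ c', ∃ h : c' ∈ (chartedSpaceCore hπ).atlas,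
        c = (chartedSpaceCore hπ).openPartialHomeomorph c' h := by
    simp [atlas, ChartedSpace.atlas]
  rw [hcore]
  constructor
  · rintro ⟨_, ⟨φ, hφ, rfl⟩, rfl⟩
    exact ⟨φ, hφ, rfl⟩
  · rintro ⟨φ, hφ, rfl⟩
    exact ⟨_, ⟨φ, hφ, rfl⟩, rfl⟩

theorem inducedChart_mem_atlas (hπ : Manifold.IsSubmersion (𝓡 (n + k)) (𝓡 n) ∞ π)
    (hφ : IsAdaptedChart π φ) :
    inducedChart hπ hφ ∈ atlas (Model n k) (AdaptedFrameBundle hπ) :=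
  mem_atlas_iff.2 ⟨φ, hφ, rfl⟩

theorem mdifferentiableAt_pt (hφ : IsAdaptedChart π φ) {u : AdaptedFrameBundle hπ}
    (hu : u.pt ∈ φ.source) :
    MDifferentiableAt 𝓘(ℝ, Model n k) (𝓡 (n + k))
      (AdaptedFrameBundle.pt : AdaptedFrameBundle hπ → E) u := by
  have hus : u ∈ (inducedChart hπ hφ).source := hu
  have hchart : MDifferentiableAt 𝓘(ℝ, Model n k) 𝓘(ℝ, Model n k) (inducedChart hπ hφ) u :=
    (mdifferentiable_of_mem_atlas (inducedChart_mem_atlas hπ hφ)).mdifferentiableAt hus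
  have hfst : MDifferentiableAt 𝓘(ℝ, Model n k) (𝓡 (n + k))
      (Prod.fst : Model n k → EuclideanSpace ℝ (Fin (n + k))) (inducedChart hπ hφ u) :=
    differentiableAt_fst.mdifferentiableAt
  have hsymm : MDifferentiableAt (𝓡 (n + k)) (𝓡 (n + k)) φ.symm (φ u.pt) :=
    hφ.mdifferentiable.mdifferentiableAt_symm (φ.map_source hu)
  refine (hsymm.comp u (hfst.comp u hchart)).congr_of_eventuallyEq ?_
  filter_upwards [(inducedChart hπ hφ).open_source.mem_nhds hus] with v hv
  exact (φ.left_inv hv).symm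

section

variable (hφ : IsAdaptedChart π φ) {q : Model n k}

theorem inducedChart_apply (u : AdaptedFrameBundle hπ) : inducedChart hπ hφ u = coord φ u := rfl

theorem coord_inducedChart_symm (hq : q ∈ (inducedChart hπ hφ).target) :
    coord φ ((inducedChart hπ hφ).symm q) = q :=
  (inducedChart hπ hφ).right_inv hq

theorem pt_inducedChart_symm_mem (hq : q ∈ (inducedChart hπ hφ).target) :
    ((inducedChart hπ hφ).symm q).pt ∈ φ.source :=
  (inducedChart hπ hφ).map_target hq

theorem velocity_inducedChart_symm (hq : q ∈ (inducedChart hπ hφ).target) :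
    velocity φ ((inducedChart hπ hφ).symm q) = ofBlocks q.2 := by
  rw [← ofBlocks_coord hφ _ (pt_inducedChart_symm_mem hφ hq), coord_inducedChart_symm hφ hq]

theorem fundamentalDeriv_inducedChart_symm {L : AdaptedFrameBundle hπ → ℝ}
    (hq : q ∈ (inducedChart hπ hφ).target)
    (hL : DifferentiableAt ℝ (L ∘ (inducedChart hπ hφ).symm) q)
    {ξ : Matrix (Fin n ⊕ Fin k) (Fin n ⊕ Fin k) ℝ}
    (hξ : ∀ (i : Fin n) (A : Fin k), ξ (Sum.inl i) (Sum.inr A) = 0) :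
    fundamentalDeriv ξ hξ L ((inducedChart hπ hφ).symm q) =
      fderiv ℝ (L ∘ (inducedChart hπ hφ).symm) q (0, verticalDir q.2 ξ) := by
  set u := (inducedChart hπ hφ).symm q
  have hu : u.pt ∈ φ.source := pt_inducedChart_symm_mem hφ hq
  have horbit (t : ℝ) : L (u.act (NormedSpace.exp (t • ξ)) (isUnit_det_exp _) (exp_lower hξ t)) =
      (L ∘ (inducedChart hπ hφ).symm) (q.1, verticalDir q.2 (NormedSpace.exp (t • ξ))) := by
    have hut : u.act (NormedSpace.exp (t • ξ)) (isUnit_det_exp _) (exp_lower hξ t) ∈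
        (inducedChart hπ hφ).source := hu
    rw [← coord_inducedChart_symm hφ hq, ← coord_act hφ hu (isUnit_det_exp _) (exp_lower hξ t),
      ← inducedChart_apply hφ, Function.comp_apply, (inducedChart hπ hφ).left_inv hut]
  have hcurve : HasDerivAt (fun t : ℝ => (q.1, verticalDir q.2 (NormedSpace.exp (t • ξ))))
      (0, verticalDir q.2 ξ) 0 :=
    (hasDerivAt_const (0 : ℝ) q.1).prodMk (hasDerivAt_linearMap_exp_smul (verticalDir q.2) ξ)
  have hstart : q = (q.1, verticalDir q.2 (NormedSpace.exp ((0 : ℝ) • ξ))) := by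
    rw [zero_smul, NormedSpace.exp_zero, verticalDir_one]
  rw [fundamentalDeriv, funext horbit]
  exact (hL.hasFDerivAt.comp_hasDerivAt_of_eq (0 : ℝ) hcurve hstart).deriv

theorem contDiffOn_comp_inducedChart_symm {L : AdaptedFrameBundle hπ → ℝ}
    (hL : ContMDiff 𝓘(ℝ, Model n k) 𝓘(ℝ, ℝ) ∞ L) :
    ContDiffOn ℝ ∞ (L ∘ (inducedChart hπ hφ).symm) (inducedChart hπ hφ).target := by
  rw [← contMDiffOn_iff_contDiffOn]
  exact hL.comp_contMDiffOn (contMDiffOn_symm_of_mem_maximalAtlas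
    (IsManifold.subset_maximalAtlas (inducedChart_mem_atlas hπ hφ)))

theorem differentiableAt_comp_inducedChart_symm {L : AdaptedFrameBundle hπ → ℝ}
    (hL : ContMDiff 𝓘(ℝ, Model n k) 𝓘(ℝ, ℝ) ∞ L) (hq : q ∈ (inducedChart hπ hφ).target) :
    DifferentiableAt ℝ (L ∘ (inducedChart hπ hφ).symm) q :=
  ((contDiffOn_comp_inducedChart_symm hφ hL).contDiffAt
    ((inducedChart hπ hφ).open_target.mem_nhds hq)).differentiableAt (by simp)

theorem chartDeriv_mfderiv_pt_inducedChart_symm (hq : q ∈ (inducedChart hπ hφ).target)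
    (Y : Model n k) :
    chartDeriv φ ((inducedChart hπ hφ).symm q).pt
      (mfderiv 𝓘(ℝ, Model n k) (𝓡 (n + k)) (AdaptedFrameBundle.pt : AdaptedFrameBundle hπ → E)
        ((inducedChart hπ hφ).symm q)
        (mfderiv 𝓘(ℝ, Model n k) 𝓘(ℝ, Model n k) (inducedChart hπ hφ).symm q Y)) = Y.1 := by
  have hu := pt_inducedChart_symm_mem hφ hq
  have hpt := mdifferentiableAt_pt hφ hu
  have hφd := hφ.mdifferentiable.mdifferentiableAt hu
  have hsymm := (mdifferentiable_of_mem_atlas (I := 𝓘(ℝ, Model n k))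
    (inducedChart_mem_atlas hπ hφ)).mdifferentiableAt_symm hq
  have hchain := mfderiv_comp q (hφd.comp _ hpt) hsymm
  have hfst : (φ ∘ AdaptedFrameBundle.pt) ∘ (inducedChart hπ hφ).symm =ᶠ[𝓝 q] Prod.fst :=
    Filter.eventuallyEq_of_mem ((inducedChart hπ hφ).open_target.mem_nhds hq) fun _ hx =>
      congrArg Prod.fst (coord_inducedChart_symm hφ hx)
  rw [mfderiv_comp _ hφd hpt, hfst.mfderiv_eq, mfderiv_eq_fderiv, fderiv_fst] at hchain
  exact (congrArg (fun T => T Y) hchain).symm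

theorem soldering_inducedChart_symm (hq : q ∈ (inducedChart hπ hφ).target) (Y : Model n k) :
    soldering ((inducedChart hπ hφ).symm q)
      (mfderiv 𝓘(ℝ, Model n k) 𝓘(ℝ, Model n k) (inducedChart hπ hφ).symm q Y) =
        localSoldering q Y := by
  set u := (inducedChart hπ hφ).symm q
  have hbase : ofBlocks q.2 (soldering u
      (mfderiv 𝓘(ℝ, Model n k) 𝓘(ℝ, Model n k) (inducedChart hπ hφ).symm q Y)) = Y.1 := by
    rw [← velocity_inducedChart_symm hφ hq]
    exact (congrArg (chartDeriv φ u.pt) (u.frameIso.apply_symm_apply _)).trans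
      (chartDeriv_mfderiv_pt_inducedChart_symm hφ hq Y)
  rw [localSoldering_apply, ← hbase, coframe, hq.2.inverse_apply_self]

end

/-- The coordinate expression of the coefficients `(τ L, E^{*i}_A(L))` of the
Cartan-Hamilton-Poincaré form, in terms of the coordinate expression `ℓ` of `L`. -/
noncomputable def chpCoefficients (τ : ℝ) (ℓ : Model n k → ℝ) (q : Model n k) :
    ℝ × (Fin n → Fin k → ℝ) :=
  (τ * ℓ q,
    fun i A => fderiv ℝ ℓ q (0, verticalDir q.2 (Matrix.single (Sum.inr A) (Sum.inl i) 1)))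

theorem contDiffOn_chpCoefficients (τ : ℝ) {ℓ : Model n k → ℝ} {U : Set (Model n k)}
    (hU : IsOpen U) (hℓ : ContDiffOn ℝ ∞ ℓ U) : ContDiffOn ℝ ∞ (chpCoefficients τ ℓ) U := by
  have hvertical (ξ : Matrix (Fin n ⊕ Fin k) (Fin n ⊕ Fin k) ℝ) :
      ContDiff ℝ ∞ fun q : Model n k => verticalDir q.2 ξ :=
    (LinearMap.toContinuousLinearMap (blocks (n := n) (k := k))).contDiff.comp
      (contDiff_ofBlocks_snd.clm_comp contDiff_const)
  exact (contDiffOn_const.mul hℓ).prodMk (contDiffOn_pi.2 fun i => contDiffOn_pi.2 fun A =>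
    (hℓ.fderiv_of_isOpen hU (by simp)).clm_apply (contDiff_const.prodMk (hvertical _)).contDiffOn)

theorem fderiv_chpCoefficients_fst {τ : ℝ} {ℓ : Model n k → ℝ} {q : Model n k}
    (h : DifferentiableAt ℝ (chpCoefficients τ ℓ) q) (hℓ : DifferentiableAt ℝ ℓ q)
    (X : Model n k) : (fderiv ℝ (chpCoefficients τ ℓ) q X).1 = τ * fderiv ℝ ℓ q X := by
  have hfst : HasFDerivAt (fun q => τ * ℓ q) _ q := h.hasFDerivAt.fst
  exact congrArg (fun D => D X) (hfst.unique (hℓ.hasFDerivAt.const_mul τ))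

theorem sum_horizontalDeriv_inducedChart_symm (hφ : IsAdaptedChart π φ)
    {L : AdaptedFrameBundle hπ → ℝ} {q : Model n k} (hq : q ∈ (inducedChart hπ hφ).target)
    (hL : DifferentiableAt ℝ (L ∘ (inducedChart hπ hφ).symm) q) :
    ∑ i, horizontalDeriv i i L ((inducedChart hπ hφ).symm q) =
      fderiv ℝ (L ∘ (inducedChart hπ hφ).symm) q
        (0, verticalDir q.2 (Matrix.fromBlocks 1 0 0 0)) := by
  have hunit : ∑ i : Fin n, Matrix.single (Sum.inl i) (Sum.inl i) (1 : ℝ) =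
      (Matrix.fromBlocks 1 0 0 0 : Matrix (Fin n ⊕ Fin k) (Fin n ⊕ Fin k) ℝ) := by
    ext (i | A) (j | B) <;> simp [Matrix.sum_apply, Matrix.single_apply, Matrix.one_apply, ite_and]
  let D : Matrix (Fin n ⊕ Fin k) (Fin n ⊕ Fin k) ℝ →ₗ[ℝ] ℝ :=
    (fderiv ℝ (L ∘ (inducedChart hπ hφ).symm) q).toLinearMap ∘ₗ
      LinearMap.inr ℝ _ _ ∘ₗ verticalDir q.2
  simp only [horizontalDeriv, fundamentalDeriv_inducedChart_symm hφ hq hL, ← hunit]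
  exact (map_sum D _ _).symm

section

variable (τ : ℝ) {L : AdaptedFrameBundle hπ → ℝ}

theorem inChart_chpForm (hL : ContMDiff 𝓘(ℝ, Model n k) 𝓘(ℝ, ℝ) ∞ L)
    (hφ : IsAdaptedChart π φ) {q : Model n k} (hq : q ∈ (inducedChart hπ hφ).target) :
    ManifoldForm.inChart (ManifoldForm.ofOneForm (chpForm τ L)) (inducedChart hπ hφ) q =
      ContinuousAlternatingMap.ofSubsingleton ℝ (Model n k) (Fin n ⊕ Fin k → ℝ) (0 : Fin 1)
        (localForm (chpCoefficients τ (L ∘ (inducedChart hπ hφ).symm)) q) := by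
  have hLq := differentiableAt_comp_inducedChart_symm hφ hL hq
  ext v a
  change chpForm τ L ((inducedChart hπ hφ).symm q)
    (mfderiv 𝓘(ℝ, Model n k) 𝓘(ℝ, Model n k) (inducedChart hπ hφ).symm q (v 0)) a =
    chpMatrix (chpCoefficients τ (L ∘ (inducedChart hπ hφ).symm) q) (localSoldering q (v 0)) a
  rw [← soldering_inducedChart_symm hφ hq]
  rcases a with i | A
  · simp [chpMatrix_apply_inl, chpCoefficients, chpForm, momentum,
      fundamentalDeriv_inducedChart_symm hφ hq hLq]
  · simp [chpMatrix_apply_inr, chpForm]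

theorem contDiffOn_chpCoefficients_inducedChart
    (hL : ContMDiff 𝓘(ℝ, Model n k) 𝓘(ℝ, ℝ) ∞ L) (hφ : IsAdaptedChart π φ) :
    ContDiffOn ℝ ∞ (chpCoefficients τ (L ∘ (inducedChart hπ hφ).symm))
      (inducedChart hπ hφ).target :=
  contDiffOn_chpCoefficients τ (inducedChart hπ hφ).open_target
    (contDiffOn_comp_inducedChart_symm hφ hL)

theorem isSmooth_chpForm (hL : ContMDiff 𝓘(ℝ, Model n k) 𝓘(ℝ, ℝ) ∞ L) :
    ManifoldForm.IsSmooth (ManifoldForm.ofOneForm (chpForm τ L)) := by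
  intro c hc
  obtain ⟨φ, hφ, rfl⟩ := mem_atlas_iff.1 hc
  have hform : ContDiffOn ℝ ∞ (localForm (chpCoefficients τ (L ∘ (inducedChart hπ hφ).symm)))
      (inducedChart hπ hφ).target :=
    contDiffOn_localForm (fun q hq => hq.2) (contDiffOn_chpCoefficients_inducedChart τ hL hφ)
  have hofSubsingleton := (ContinuousAlternatingMap.ofSubsingletonLIE (𝕜 := ℝ) (E := Model n k)
    (F := Fin n ⊕ Fin k → ℝ) (0 : Fin 1)).contDiff (n := ∞)
  exact (hofSubsingleton.comp_contDiffOn hform).congr fun q hq => inChart_chpForm τ hL hφ hq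

theorem extDeriv_inChart_chpForm (hL : ContMDiff 𝓘(ℝ, Model n k) 𝓘(ℝ, ℝ) ∞ L)
    (hφ : IsAdaptedChart π φ) {q : Model n k} (hq : q ∈ (inducedChart hπ hφ).target)
    (X Y : Model n k) :
    extDeriv (ManifoldForm.inChart (ManifoldForm.ofOneForm (chpForm τ L)) (inducedChart hπ hφ)) q
        ![X, Y] =
      localTwoForm (chpCoefficients τ (L ∘ (inducedChart hπ hφ).symm)) q X Y := by
  have hnhds := (inducedChart hπ hφ).open_target.mem_nhds hq
  rw [(Filter.eventuallyEq_of_mem hnhds fun x hx => inChart_chpForm τ hL hφ hx).extDeriv_eq]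
  exact extDeriv_localForm hq.2
    (((contDiffOn_chpCoefficients_inducedChart τ hL hφ).contDiffAt hnhds).differentiableAt
      (by simp))

end

theorem d_chpForm_nondegenerate {τ : ℝ} (hτ : τ ≠ 0) {L : AdaptedFrameBundle hπ → ℝ}
    (hL : ContMDiff 𝓘(ℝ, Model n k) 𝓘(ℝ, ℝ) ∞ L) (hL0 : ∀ u, L u ≠ 0)
    (hsum : ∀ u, ∑ i, horizontalDeriv i i L u ≠ L u) (u : AdaptedFrameBundle hπ)
    (X : TangentSpace 𝓘(ℝ, Model n k) u) :
    (∀ Y : TangentSpace 𝓘(ℝ, Model n k) u,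
      ManifoldForm.d (ManifoldForm.ofOneForm (chpForm τ L)) u ![X, Y] = 0) ↔ X = 0 := by
  refine ManifoldForm.d_nondegenerate (fun c hc q hq X hX => ?_) u X
  obtain ⟨φ, hφ, rfl⟩ := mem_atlas_iff.1 hc
  have hℓ := differentiableAt_comp_inducedChart_symm hφ hL hq
  have hm := ((contDiffOn_chpCoefficients_inducedChart τ hL hφ).contDiffAt
    ((inducedChart hπ hφ).open_target.mem_nhds hq)).differentiableAt (by simp)
  refine localTwoForm_nondegenerate hq.2 (mul_ne_zero hτ (hL0 _)) ?_
    fun Y => (extDeriv_inChart_chpForm τ hL hφ hq X Y).symm.trans (hX Y)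
  rw [fderiv_chpCoefficients_fst hm hℓ, ← sum_horizontalDeriv_inducedChart_symm hφ hq hℓ]
  exact fun h => hsum _ (mul_left_cancel₀ hτ h)

end AdaptedFrameBundle

theorem mainTheorem12_general {n k : ℕ} (hm : 1 ≤ n + k)
    {M : Type*} [TopologicalSpace M] [ChartedSpace (EuclideanSpace ℝ (Fin n)) M]
    [IsManifold (𝓡 n) ∞ M]
    {E : Type*} [TopologicalSpace E] [ChartedSpace (EuclideanSpace ℝ (Fin (n + k))) E]
    [IsManifold (𝓡 (n + k)) ∞ E]
    {π : E → M} {hπ : Manifold.IsSubmersion (𝓡 (n + k)) (𝓡 n) ∞ π}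
    {τ : ℝ} (hτ : τ ≠ 0) {L : AdaptedFrameBundle hπ → ℝ}
    (hL : ContMDiff 𝓘(ℝ, EuclideanSpace ℝ (Fin (n + k)) × AdaptedFrameBundle.FrameModel n k)
      𝓘(ℝ, ℝ) ∞ L)
    (hL0 : ∀ u, L u ≠ 0)
    (hsum : ∀ u, ∑ i, AdaptedFrameBundle.horizontalDeriv i i L u ≠ L u) :
    ManifoldForm.IsMSymplectic (ι := Fin n ⊕ Fin k) (P := AdaptedFrameBundle hπ)
      (ManifoldForm.d (ManifoldForm.ofOneForm (AdaptedFrameBundle.chpForm τ L))) := by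
  have hsmooth := AdaptedFrameBundle.isSmooth_chpForm τ hL
  refine ⟨inferInstance, by simpa using hm, ?_, hsmooth.d, hsmooth.d_d,
    AdaptedFrameBundle.d_chpForm_nondegenerate hτ hL hL0 hsum⟩
  simp only [Fintype.card_sum, Fintype.card_fin, Module.finrank_prod, finrank_euclideanSpace_fin]
  exact Nat.le_add_right _ _

theorem mainTheorem12 {n k : ℕ} (hm : 1 ≤ n + k)
    {M : Type*} [TopologicalSpace M] [ChartedSpace (EuclideanSpace ℝ (Fin n)) M]
    [IsManifold (𝓡 n) ∞ M]
    {E : Type*} [TopologicalSpace E] [ChartedSpace (EuclideanSpace ℝ (Fin (n + k))) E]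
    [IsManifold (𝓡 (n + k)) ∞ E]
    {π : E → M} (hπ : Manifold.IsSubmersion (𝓡 (n + k)) (𝓡 n) ∞ π)
    (τ : ℕ → ℝ) (hτ : 0 < τ n)
    (L : AdaptedFrameBundle hπ → ℝ) (hL : AdaptedFrameBundle.IsLiftedLagrangian L)
    (hL0 : ∀ u, L u ≠ 0) :
    ManifoldForm.IsMSymplectic (ι := Fin n ⊕ Fin k) (P := AdaptedFrameBundle hπ)
      (ManifoldForm.d (ManifoldForm.ofOneForm (AdaptedFrameBundle.chpForm (τ n) L))) :=
  mainTheorem12_general hm hτ.ne' hL.smooth hL0 fun u => by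
    simpa [hL.horizontalDeriv_eq_zero] using (hL0 u).symm
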